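/- For an abstract group $G$, let $\widehat{G}$ denote its profinite completion (the inverse limit of the finite quotients of $G$) with canonical homomorphism $\eta_G\colon G\to\widehat{G}$, and let $\mathrm{Out}\,G=\mathrm{Aut}\,G/\mathrm{Int}\,G$, where $\mathrm{Int}\,G$ is the group of inner automorphisms. For a profinite group $P$, let $\mathrm{Aut}\,P$ be the group of continuous automorphisms of $P$ with the topology of uniform convergence, and let $\mathrm{Out}\,P=\mathrm{Aut}\,P/\mathrm{Int}\,P$ with the quotient topology. Every automorphism of $G$ extends uniquely to a continuous automorphism of $\widehat{G}$, and this induces a natural homomorphism $\omega\colon\mathrm{Out}\,G\to\mathrm{Out}\,\widehat{G}$. **Main Theorem.** Let $G=F_2$ be the free group on two generators. Then the natural homomorphism $\omega\colon \mathrm{Out}\,F_2\to\mathrm{Out}\,\widehat{F_2}$ extends uniquely to a continuous homomorphism $$\psi\colon \widehat{\mathrm{Out}\,F_2}\longrightarrow \mathrm{Out}\,\widehat{F_2},\qquad \psi\circ\eta_{\mathrm{Out}\,F_2}=\omega,$$ and $\psi$ is injective. -/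

import Mathlib

/-! ### Outer automorphisms of an abstract group -/

/-- The group `Int G` of inner automorphisms of an abstract group `G`. -/
abbrev Inn (G : Type*) [Group G] : Subgroup (MulAut G) := (MulAut.conj (G := G)).range

instance Inn.normal (G : Type*) [Group G] : (Inn G).Normal where
  conj_mem := by
    rintro _ ⟨g, rfl⟩ σ
    refine ⟨σ g, ?_⟩
    ext h
    simp [MulAut.mul_apply]

/-- The outer automorphism group `Out G = Aut G / Int G` of an abstract group `G`. -/
abbrev Out (G : Type*) [Group G] : Type _ := MulAut G ⧸ Inn G

/-! ### Continuous automorphisms of a topological group -/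

namespace ContAut

section Group

variable {G : Type*} [Group G] [TopologicalSpace G]

/-- The continuous automorphisms of a topological group (automorphisms that are homeomorphisms)
form a group under composition. -/
instance instGroup : Group (G ≃ₜ* G) where
  mul σ τ := τ.trans σ
  one := ContinuousMulEquiv.refl G
  inv σ := σ.symm
  mul_assoc _ _ _ := rfl
  one_mul _ := rfl
  mul_one _ := rfl
  inv_mul_cancel σ := ContinuousMulEquiv.ext σ.symm_apply_apply

@[simp] theorem mul_apply (σ τ : G ≃ₜ* G) (x : G) : (σ * τ) x = σ (τ x) := rfl

@[simp] theorem one_apply (x : G) : (1 : G ≃ₜ* G) x = x := rfl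

@[simp] theorem apply_inv_self (σ : G ≃ₜ* G) (x : G) : σ (σ⁻¹ x) = x := σ.apply_symm_apply x

@[simp] theorem inv_apply_self (σ : G ≃ₜ* G) (x : G) : σ⁻¹ (σ x) = x := σ.symm_apply_apply x

/-- The compact-open topology on the group of continuous automorphisms; for compact `G` this is the
topology of uniform convergence. -/
instance instTopologicalSpace : TopologicalSpace (G ≃ₜ* G) :=
  TopologicalSpace.induced (fun σ : G ≃ₜ* G => (⟨σ, σ.continuous_toFun⟩ : C(G, G))) inferInstance

end Group

variable (G : Type*) [Group G] [TopologicalSpace G] [IsTopologicalGroup G]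

/-- Conjugation `g ↦ (h ↦ g * h * g⁻¹)`, as a homomorphism into the continuous automorphisms. -/
def conj : G →* (G ≃ₜ* G) where
  toFun g :=
    { MulAut.conj g with
      continuous_toFun := (continuous_const.mul continuous_id).mul continuous_const
      continuous_invFun := (continuous_const.mul continuous_id).mul continuous_const }
  map_one' := ContinuousMulEquiv.ext fun h => by
    change 1 * h * 1⁻¹ = h
    simp
  map_mul' a b := ContinuousMulEquiv.ext fun h => by
    change a * b * h * (a * b)⁻¹ = a * (b * h * b⁻¹) * a⁻¹
    simp [mul_assoc]

theorem conj_apply (g h : G) : conj G g h = g * h * g⁻¹ := rfl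

/-- The group `Int G` of inner automorphisms of a topological group `G`. -/
abbrev inn : Subgroup (G ≃ₜ* G) := (conj G).range

instance inn_normal : (inn G).Normal where
  conj_mem := by
    rintro _ ⟨g, rfl⟩ σ
    refine ⟨σ g, ContinuousMulEquiv.ext fun h => ?_⟩
    simp [conj_apply]

end ContAut

/-- The outer automorphism group `Out G` of a topological group `G`: continuous automorphisms
modulo inner ones, with the quotient topology. -/
abbrev ContOut (G : Type*) [Group G] [TopologicalSpace G] [IsTopologicalGroup G] : Type _ :=
  (G ≃ₜ* G) ⧸ ContAut.inn G

/-! ### The natural homomorphism `Out G → Out Ĝ` -/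

universe u

/-- The profinite completion `Ĝ` of an abstract group `G`, the limit of the quotients of `G` by its
normal subgroups of finite index. -/
noncomputable abbrev ProfCompl (G : Type u) [Group G] : ProfiniteGrp.{u} :=
  ProfiniteGrp.profiniteCompletion.obj (GrpCat.of G)

namespace ProfCompl

open CategoryTheory

variable (G : Type u) [Group G]

/-- The canonical homomorphism from `G` to its profinite completion. -/
noncomputable def eta : G →* ProfCompl G := (ProfiniteGrp.ProfiniteCompletion.eta (GrpCat.of G)).hom

variable {G}

/-- Continuous homomorphisms out of `Ĝ` that agree on the image of `G` are equal. -/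
theorem hom_ext {f g : ProfCompl G →ₜ* ProfCompl G} (h : ∀ x, f (eta G x) = g (eta G x)) :
    f = g := by
  have hd : DenseRange (eta G) := ProfiniteGrp.ProfiniteCompletion.denseRange (GrpCat.of G)
  ext x
  exact congrFun (hd.equalizer f.continuous_toFun g.continuous_toFun (funext h)) x

/-- The continuous endomorphism of `Ĝ` induced by an endomorphism of `G`. -/
noncomputable def map (f : G →* G) : ProfCompl G →ₜ* ProfCompl G :=
  (ProfiniteGrp.profiniteCompletion.map (GrpCat.ofHom f)).hom

theorem map_eta (f : G →* G) (x : G) : map f (eta G x) = eta G (f x) :=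
  ConcreteCategory.congr_hom
    (ProfiniteGrp.ProfiniteCompletion.lift_eta
      (GrpCat.ofHom f ≫ ProfiniteGrp.ProfiniteCompletion.eta (GrpCat.of G))) x

theorem map_map_of_inverse {f g : G →* G} (h : ∀ x, f (g x) = x) (x : ProfCompl G) :
    map f (map g x) = x := by
  have : (map f).comp (map g) = ContinuousMonoidHom.id _ := hom_ext fun y => by
    change map f (map g (eta G y)) = eta G y
    rw [map_eta, map_eta, h]
  exact DFunLike.congr_fun this x

variable (G)

/-- The natural homomorphism `Aut G → Aut Ĝ`. -/
noncomputable def autMap : MulAut G →* (ProfCompl G ≃ₜ* ProfCompl G) where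
  toFun σ :=
    { toFun := map σ.toMonoidHom
      invFun := map σ.symm.toMonoidHom
      left_inv := map_map_of_inverse σ.symm_apply_apply
      right_inv := map_map_of_inverse σ.apply_symm_apply
      map_mul' := map_mul (map σ.toMonoidHom)
      continuous_toFun := (map σ.toMonoidHom).continuous_toFun
      continuous_invFun := (map σ.symm.toMonoidHom).continuous_toFun }
  map_one' := ContinuousMulEquiv.ext fun x =>
    DFunLike.congr_fun (hom_ext (f := map (1 : MulAut G).toMonoidHom)
      (g := ContinuousMonoidHom.id _) fun y => map_eta _ y) x
  map_mul' σ τ := ContinuousMulEquiv.ext fun x =>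
    DFunLike.congr_fun (hom_ext (f := map (σ * τ).toMonoidHom)
      (g := (map σ.toMonoidHom).comp (map τ.toMonoidHom)) fun y => by
        change map _ (eta G y) = map _ (map _ (eta G y))
        rw [map_eta, map_eta, map_eta]
        rfl) x

theorem autMap_eta (σ : MulAut G) (x : G) : autMap G σ (eta G x) = eta G (σ x) :=
  map_eta _ x

theorem autMap_conj (g : G) : autMap G (MulAut.conj g) = ContAut.conj (ProfCompl G) (eta G g) :=
  ContinuousMulEquiv.ext fun x =>
    DFunLike.congr_fun (hom_ext (f := map (MulAut.conj g).toMonoidHom)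
      (g := ⟨(ContAut.conj (ProfCompl G) (eta G g)).toMulEquiv.toMonoidHom,
        (ContAut.conj (ProfCompl G) (eta G g)).continuous_toFun⟩) fun y => by
        rw [map_eta]
        change eta G (g * y * g⁻¹) = eta G g * eta G y * (eta G g)⁻¹
        simp) x

/-- The natural homomorphism `Out G → Out Ĝ`, induced by `Aut G → Aut Ĝ`. -/
noncomputable def outMap : Out G →* ContOut (ProfCompl G) :=
  QuotientGroup.map (Inn G) (ContAut.inn (ProfCompl G)) (autMap G) (by
    rintro _ ⟨g, rfl⟩
    exact ⟨eta G g, (autMap_conj G g).symm⟩)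

/-- A continuous homomorphism from the profinite completion of `Out G` to `Out Ĝ` that extends the
natural homomorphism `Out G → Out Ĝ`. -/
def ExtendsOutMap (ψ : ProfCompl (Out G) →ₜ* ContOut (ProfCompl G)) : Prop :=
  ∀ a : Out G, ψ (eta (Out G) a) = outMap G a

end ProfCompl

/-!
The proof has an arithmetic half, a congruence subgroup property for `Out F₂`, and a formal half,
which turns it into injectivity on profinite completions.

*The congruence subgroup property* (`FreeGroup.exists_finite_quotient_out`). Let `H` be a subgroup
of finite index of `Out F₂`; one needs a finite quotient of `F₂` such that every automorphism acting
on it as an inner automorphism has its class in `H`. By Nielsen's theorem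
(`FreeGroup.mulAut_mem_of_generators`) and a coset computation, an automorphism that is trivial on
the abelianization modulo four is inner times a product of the two twists `b ↦ a² b` and
`a ↦ a b⁻²` (`FreeGroup.exists_eq_conj_mul_sanovAction`), so only a free group `Γ` of twists and a
finite quotient `f` of `Γ` matter.

The elliptic involution makes the once-punctured torus and the four-punctured sphere coverings of
one orbifold, with Klein four-group `V` for the sphere. Its algebraic form is a homomorphism from
`F₂` to the wreath product by `V` of the fundamental group `⟨c, p, q⟩` of the sphere
(`FreeGroup.sphereCocycle`), under which the twists become pure mapping classes of the sphere.
Inside the pure mapping class group `T` of the five-punctured sphere, `Γ` lifts to a group `⟨α, β⟩`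
that acts on `⟨c, p, q⟩` by conjugation, and `T → Γ` with kernel `⟨c, p, q⟩` is a retraction. The
gain is that `T` is fibred in a second way, as `Free(c, A, B) ⋊ Free(p, q)`. If `γ ∈ Γ` acts on a
sufficiently fine finite quotient as an inner automorphism, then some `g ∈ T` with the image `γ` in
`Γ` commutes with `c², p², q²` in a finite quotient of `T`. In a finite quotient of a free group
that is fine enough, the centralizer of the square of a basis element is visibly the cyclic group
generated by that element (`FreeGroup.exists_finite_quotient_commute_sq`). Applied to `p²` and `q²`
in the base this shows that the base part of `g` acts trivially on the fibre modulo a given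
characteristic subgroup, and then, applied to `c²` in the fibre, that the fibre part of `g` is a
power of `c` there. Since `c`, `p` and `q` map to `1` in `Γ`, this gives `f γ = 1`
(`FreeGroup.exists_finite_quotient_sanovAction`).

*Profinite completions.* For finitely generated `G` the open characteristic subgroups of `Ĝ` form a
basis of neighbourhoods of the identity. Hence `Aut Ĝ` carries the topology of pointwise
convergence and is compact, and `Out Ĝ` is profinite, so that `Out G → Out Ĝ` extends to the
completion, uniquely by density. For the extension `ψ`, an element `ξ ≠ 1` lies outside an open
normal subgroup `U`, and the congruence subgroup property provides an open subgroup of `Out Ĝ` whose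
trace on `Out G` lies in `U`; an element of `Out G` close to `ξ` then shows that `ψ ξ = 1` is
impossible (`ProfCompl.ExtendsOutMap.injective`).
-/

/-! ### The Gromov product on a free group -/

namespace FreeGroup

/-- The length of the longest common prefix of two lists. -/
def commonPrefixLength {α : Type*} [DecidableEq α] : List α → List α → ℕ
  | a :: l, b :: m => if a = b then commonPrefixLength l m + 1 else 0
  | _, _ => 0

theorem invRev_cons_eq_append {α : Type*} (a : α × Bool) (l : List (α × Bool)) :
    invRev (a :: l) = invRev l ++ [(a.1, !a.2)] := by
  simp [invRev]

section Lists

variable {α : Type*} [DecidableEq α]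

theorem commonPrefixLength_comm (l m : List α) :
    commonPrefixLength l m = commonPrefixLength m l := by
  induction l generalizing m with
  | nil => cases m <;> rfl
  | cons a l ih =>
    cases m with
    | nil => rfl
    | cons b m => simp only [commonPrefixLength, ih m, eq_comm]

theorem min_commonPrefixLength_le (l m n : List α) :
    min (commonPrefixLength l m) (commonPrefixLength m n) ≤ commonPrefixLength l n := by
  induction m generalizing l n with
  | nil => cases l <;> simp [commonPrefixLength]
  | cons b m ih =>
    cases l with
    | nil => simp [commonPrefixLength]
    | cons a l =>
      cases n with
      | nil => simp [commonPrefixLength]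
      | cons c n =>
        have := ih l n
        simp only [commonPrefixLength]
        split_ifs with h1 h2 h3 h4 <;> simp_all

theorem commonPrefixLength_append {l m : List α} (x y : List α)
    (hl : commonPrefixLength l m < l.length) (hm : commonPrefixLength l m < m.length) :
    commonPrefixLength (l ++ x) (m ++ y) = commonPrefixLength l m := by
  induction l generalizing m with
  | nil => simp at hl
  | cons a l ih =>
    cases m with
    | nil => simp at hm
    | cons b m =>
      simp only [commonPrefixLength, List.cons_append] at *
      split_ifs with h
      · rw [if_pos h] at hl hm
        rw [ih (by simpa using hl) (by simpa using hm)]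
      · rfl

theorem IsReduced.invRev {l : List (α × Bool)} (h : IsReduced l) :
    IsReduced (FreeGroup.invRev l) := by
  rw [isReduced_iff_reduce_eq] at *
  rw [reduce_invRev, h]

/-- Cancellation in the product of two reduced words `l⁻¹` and `m` removes exactly the common
prefix of `l` and `m`. -/
theorem length_reduce_invRev_append {l m : List (α × Bool)} (hl : IsReduced l)
    (hm : IsReduced m) :
    (reduce (invRev l ++ m)).length + 2 * commonPrefixLength l m = l.length + m.length := by
  induction l generalizing m with
  | nil => simp [commonPrefixLength, hm.reduce_eq, invRev]
  | cons a l ih =>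
    cases m with
    | nil => simp [commonPrefixLength, hl.invRev.reduce_eq]
    | cons b m =>
      simp only [commonPrefixLength]
      split_ifs with h
      · subst h
        have h1 : reduce (invRev (a :: l) ++ a :: m) = reduce (invRev l ++ m) := by
          apply reduce.Step.eq
          rw [invRev_cons_eq_append]
          have := @Red.Step.not α (invRev l) m a.1 (!a.2)
          simpa using this
        rw [h1]
        have := ih (List.IsChain.of_cons hl) (List.IsChain.of_cons hm)
        simp only [List.length_cons]
        omega
      · have h1 : IsReduced (invRev (a :: l) ++ b :: m) := by
          have h2 := hl.invRev
          unfold IsReduced at h2 hm ⊢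
          rw [List.isChain_append]
          refine ⟨h2, hm, ?_⟩
          rw [invRev_cons_eq_append]
          intro x hx y hy hxy
          simp only [List.getLast?_append, List.getLast?_singleton, Option.some_or,
            Option.mem_def, Option.some.injEq, List.head?_cons] at hx hy
          subst hx hy
          have h3 : a.2 ≠ b.2 := fun h4 => h (Prod.ext hxy h4)
          simpa using (Bool.eq_not_of_ne h3.symm).symm
        rw [h1.reduce_eq]
        simp

/-- A reduced word and its inverse share less than half of their letters as a common prefix: else
a middle letter, or a middle pair of letters, would be its own inverse. -/
theorem two_mul_commonPrefixLength_invRev_lt {l : List (α × Bool)} (hl : IsReduced l)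
    (h0 : l ≠ []) : 2 * commonPrefixLength (invRev l) l < l.length := by
  induction l using List.bidirectionalRec with
  | nil => exact absurd rfl h0
  | singleton a =>
    have : ((a.1, !a.2) : α × Bool) ≠ a := fun h => by simpa using congrArg Prod.snd h
    simp [invRev, commonPrefixLength, this]
  | cons_append a l b ih =>
    have hr : invRev (a :: (l ++ [b])) = (b.1, !b.2) :: (invRev l ++ [(a.1, !a.2)]) := by
      simp [invRev]
    rw [hr]
    simp only [commonPrefixLength]
    split_ifs with h
    · have hl' : IsReduced (l ++ [b]) := List.IsChain.of_cons hl
      have hl2 : IsReduced l := List.IsChain.left_of_append hl'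
      have hne : l ≠ [] := by
        rintro rfl
        subst h
        simp [IsReduced] at hl
      have h1 := ih hl2 hne
      rw [commonPrefixLength_append]
      · simp; omega
      · simp; omega
      · omega
    · simp

end Lists

section Gromov

variable {α : Type*} [DecidableEq α]

/-- The Gromov product of two elements of a free group, based at the identity of the Cayley
tree. -/
def gromov (x y : FreeGroup α) : ℕ := commonPrefixLength x.toWord y.toWord

theorem gromov_comm (x y : FreeGroup α) : gromov x y = gromov y x :=
  commonPrefixLength_comm _ _

theorem min_gromov_le (x y z : FreeGroup α) : min (gromov x y) (gromov y z) ≤ gromov x z :=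
  min_commonPrefixLength_le _ _ _

theorem norm_add_two_gromov (x y : FreeGroup α) :
    norm (x⁻¹ * y) + 2 * gromov x y = norm x + norm y := by
  have := length_reduce_invRev_append (isReduced_toWord (x := x)) (isReduced_toWord (x := y))
  rwa [← toWord_inv, ← toWord_mul] at this

theorem two_gromov_inv_self_lt {x : FreeGroup α} (hx : x ≠ 1) : 2 * gromov x⁻¹ x < norm x := by
  have := two_mul_commonPrefixLength_invRev_lt (isReduced_toWord (x := x))
    (by rwa [Ne, toWord_eq_nil_iff])
  rwa [← toWord_inv] at this

theorem exists_suffix (y : FreeGroup α) {n : ℕ} (hn : n ≤ norm y) :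
    ∃ t, norm t = n ∧ norm (y * t⁻¹) + n = norm y := by
  have hy := isReduced_toWord (x := y)
  have hsplit := List.take_append_drop (norm y - n) y.toWord
  have hred : IsReduced (y.toWord.take (norm y - n)) ∧ IsReduced (y.toWord.drop (norm y - n)) := by
    rw [← hsplit] at hy
    exact ⟨List.IsChain.left_of_append hy, List.IsChain.right_of_append hy⟩
  have hmul : y = mk (y.toWord.take (norm y - n)) * mk (y.toWord.drop (norm y - n)) := by
    rw [mul_mk, hsplit, mk_toWord]
  refine ⟨mk (y.toWord.drop (norm y - n)), ?_, ?_⟩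
  · rw [norm, toWord_mk, hred.2.reduce_eq, List.length_drop, ← norm]
    omega
  · have : y * (mk (y.toWord.drop (norm y - n)))⁻¹ = mk (y.toWord.take (norm y - n)) := by
      nth_rw 1 [hmul]
      rw [mul_inv_cancel_right]
    rw [this, norm, toWord_mk, hred.1.reduce_eq, List.length_take, ← norm]
    omega

end Gromov

end FreeGroup

/-! ### Generators of the automorphism group of the free group of rank two -/

namespace FreeGroup

/-- Nielsen's criterion: let `σ` send each letter to an element a non-empty middle part of which
survives in every reduced product of three letters. Then `σ` does not decrease the length of any
reduced word. The second component of the conclusion is the inductive strengthening that leaves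
room for one more letter on the left. -/
theorem length_le_norm_of_nielsen {α β : Type*} [DecidableEq β]
    (σ : FreeGroup α →* FreeGroup β)
    (h : ∀ p q r : α × Bool, (p.1 = q.1 → p.2 = q.2) → (q.1 = r.1 → q.2 = r.2) →
      gromov (σ (mk [p]))⁻¹ (σ (mk [q])) + gromov (σ (mk [q]))⁻¹ (σ (mk [r])) <
        norm (σ (mk [q])))
    (q : α × Bool) (L : List (α × Bool)) (hL : IsReduced (q :: L)) :
    ∀ p : α × Bool, (p.1 = q.1 → p.2 = q.2) →
      gromov (σ (mk [p]))⁻¹ (σ (mk (q :: L))) = gromov (σ (mk [p]))⁻¹ (σ (mk [q])) ∧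
      (q :: L).length + gromov (σ (mk [p]))⁻¹ (σ (mk [q])) ≤ norm (σ (mk (q :: L))) := by
  induction L generalizing q with
  | nil =>
    intro p hp
    have := h p q q hp fun _ => rfl
    exact ⟨rfl, by simp only [List.length_singleton]; omega⟩
  | cons r L ih =>
    intro p hp
    have hqr : q.1 = r.1 → q.2 = r.2 := by
      simp only [IsReduced, List.isChain_cons_cons] at hL
      exact hL.1
    obtain ⟨h1, h2⟩ := ih r (List.IsChain.of_cons hL) q hqr
    have h3 := h p q r hp hqr
    have hw : mk (q :: r :: L) = mk [q] * mk (r :: L) := by simp [mul_mk]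
    rw [hw, _root_.map_mul]
    set y := σ (mk [q])
    set w := σ (mk (r :: L))
    have h4 := norm_add_two_gromov y⁻¹ w
    have h5 := norm_add_two_gromov y (y * w)
    rw [inv_inv, norm_inv_eq] at h4
    rw [inv_mul_cancel_left] at h5
    have h6 := min_gromov_le (σ (mk [p]))⁻¹ y (y * w)
    have h7 := min_gromov_le (σ (mk [p]))⁻¹ (y * w) y
    rw [gromov_comm (y * w) y] at h7
    simp only [List.length_cons] at h2 ⊢
    omega

section RankTwo

/-- The automorphism of a free group with prescribed values on the generators, given the values of
its inverse. -/
def autOfInverse {α : Type*} (f g : α → FreeGroup α) (hf : ∀ i, lift g (f i) = of i)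
    (hg : ∀ i, lift f (g i) = of i) : MulAut (FreeGroup α) :=
  MonoidHom.toMulEquiv (lift f) (lift g) (by ext i; simp [hf]) (by ext i; simp [hg])

@[simp] theorem autOfInverse_of {α : Type*} (f g : α → FreeGroup α) (hf hg) (i : α) :
    autOfInverse f g hf hg (of i) = f i := by
  simp [autOfInverse]

theorem mulAut_ext {α : Type*} {σ τ : MulAut (FreeGroup α)} (h : ∀ i, σ (of i) = τ (of i)) :
    σ = τ := by
  have : σ.toMonoidHom = τ.toMonoidHom := by ext i; exact h i
  ext x
  exact DFunLike.congr_fun this x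

/-- The transvection `a ↦ a`, `b ↦ a b` of the free group on `a, b`. -/
def transvection : MulAut (FreeGroup (Fin 2)) :=
  autOfInverse ![of 0, of 0 * of 1] ![of 0, (of 0)⁻¹ * of 1]
    (by simp [Fin.forall_fin_two]) (by simp [Fin.forall_fin_two])

/-- The automorphism exchanging the two generators. -/
def swapGens : MulAut (FreeGroup (Fin 2)) :=
  autOfInverse ![of 1, of 0] ![of 1, of 0]
    (by simp [Fin.forall_fin_two]) (by simp [Fin.forall_fin_two])

/-- The automorphism inverting the first generator. -/
def invGen : MulAut (FreeGroup (Fin 2)) :=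
  autOfInverse ![(of 0)⁻¹, of 1] ![(of 0)⁻¹, of 1]
    (by simp [Fin.forall_fin_two]) (by simp [Fin.forall_fin_two])

@[simp] theorem transvection_zero : transvection (of 0) = of 0 := by simp [transvection]
@[simp] theorem transvection_one : transvection (of 1) = of 0 * of 1 := by simp [transvection]
@[simp] theorem swapGens_zero : swapGens (of 0) = of 1 := by simp [swapGens]
@[simp] theorem swapGens_one : swapGens (of 1) = of 0 := by simp [swapGens]
@[simp] theorem invGen_zero : invGen (of 0) = (of 0)⁻¹ := by simp [invGen]
@[simp] theorem invGen_one : invGen (of 1) = of 1 := by simp [invGen]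

theorem exists_signedPerm {S : Subgroup (MulAut (FreeGroup (Fin 2)))} (hw : swapGens ∈ S)
    (hi : invGen ∈ S) (p q : Fin 2 × Bool) (h : p.1 ≠ q.1) :
    ∃ s ∈ S, s (of 0) = mk [p] ∧ s (of 1) = mk [q] := by
  have hj : swapGens * invGen * swapGens ∈ S := mul_mem (mul_mem hw hi) hw
  have h0 : ∀ i : Fin 2, mk [(i, true)] = of i := fun _ => rfl
  have h1 : ∀ i : Fin 2, mk [(i, false)] = (of i)⁻¹ := fun _ => rfl
  obtain ⟨i, b⟩ := p
  obtain ⟨j, c⟩ := q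
  -- all eight signed permutations, written in terms of the swap and the inversion
  have main : ∀ b c : Bool, ∃ s ∈ S, s (of 0) = mk [(0, b)] ∧ s (of 1) = mk [(1, c)] := by
    intro b c
    cases b <;> cases c
    · exact ⟨_, mul_mem hi hj, by simp [h1], by simp [h1]⟩
    · exact ⟨_, hi, by simp [h1], by simp [h0]⟩
    · exact ⟨_, hj, by simp [h0], by simp [h1]⟩
    · exact ⟨1, one_mem S, by simp [h0], by simp [h0]⟩
  fin_cases i <;> fin_cases j
  · simp at h
  · exact main b c
  · obtain ⟨s, hs, h2, h3⟩ := main c b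
    exact ⟨_, mul_mem hs hw, by simpa using h3, by simpa using h2⟩
  · simp at h

/-- Nielsen's theorem: the automorphisms of the free group of rank two are generated by the inner
ones, a transvection, the swap and an inversion. If no move shortens the images of the
generators, then Nielsen's criterion applies. The only obstruction to it is a pair
`x = t⁻¹ m s⁻¹`, `y = s t`, and replacing `x, y` by the conjugates of `x y, y` by `t`, which are
`m, t s`, shortens it. -/
theorem mulAut_mem_of_generators {S : Subgroup (MulAut (FreeGroup (Fin 2)))}
    (hinn : ∀ g, MulAut.conj g ∈ S) (hE : transvection ∈ S) (hw : swapGens ∈ S)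
    (hi : invGen ∈ S) (σ : MulAut (FreeGroup (Fin 2))) : σ ∈ S := by
  induction hn : norm (σ (of 0)) + norm (σ (of 1)) using Nat.strong_induction_on
    generalizing σ with
  | _ n ih =>
  by_contra hσ
  have hmin : ∀ τ, τ ∉ S → n ≤ norm (τ (of 0)) + norm (τ (of 1)) := by
    intro τ hτ
    by_contra! hlt
    exact hτ (ih _ hlt τ rfl)
  have hinv : ∀ p : Fin 2 × Bool, mk [(p.1, !p.2)] = (mk [p])⁻¹ := fun p => by
    simp [inv_mk, invRev]
  have hne : ∀ p : Fin 2 × Bool, σ (mk [p]) ≠ 1 := by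
    intro p h1
    rw [map_eq_one_iff _ σ.injective] at h1
    have := congrArg norm h1
    rw [norm, toWord_mk, norm_one] at this
    simp at this
  have hnorm : ∀ p q : Fin 2 × Bool, p.1 ≠ q.1 →
      norm (σ (mk [p])) + norm (σ (mk [q])) = n := by
    have h1 : ∀ p : Fin 2 × Bool, norm (σ (mk [p])) = norm (σ (of p.1)) := by
      rintro ⟨i, _ | _⟩
      · rw [← norm_inv_eq, ← _root_.map_inv]; rfl
      · rfl
    intro p q hpq
    rw [h1, h1, ← hn]
    obtain ⟨i, b⟩ := p
    obtain ⟨j, c⟩ := q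
    fin_cases i <;> fin_cases j <;> simp at hpq ⊢
    omega
  have hmem : ∀ s ∈ S, σ * s ∉ S := fun s hs h => hσ ((S.mul_mem_cancel_right hs).1 h)
  have hmul : ∀ p q : Fin 2 × Bool, p.1 ≠ q.1 →
      norm (σ (mk [q])) ≤ norm (σ (mk [p]) * σ (mk [q])) := by
    intro p q hpq
    obtain ⟨s, hs, h0, h1⟩ := exists_signedPerm hw hi p q hpq
    have := hmin _ (hmem _ (mul_mem hs hE))
    have h2 := hnorm p q hpq
    simp [-mul_mk, h0, h1] at this
    omega
  have hmul' : ∀ p q : Fin 2 × Bool, p.1 ≠ q.1 →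
      norm (σ (mk [p])) ≤ norm (σ (mk [p]) * σ (mk [q])) := by
    intro p q hpq
    have := hmul (q.1, !q.2) (p.1, !p.2) hpq.symm
    rw [hinv, hinv, _root_.map_inv, _root_.map_inv, ← mul_inv_rev, norm_inv_eq, norm_inv_eq] at this
    exact this
  have hg : ∀ p q : Fin 2 × Bool, p.1 ≠ q.1 →
      2 * gromov (σ (mk [p]))⁻¹ (σ (mk [q])) ≤ norm (σ (mk [p])) ∧
      2 * gromov (σ (mk [p]))⁻¹ (σ (mk [q])) ≤ norm (σ (mk [q])) := by
    intro p q hpq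
    have h1 := norm_add_two_gromov (σ (mk [p]))⁻¹ (σ (mk [q]))
    rw [inv_inv, norm_inv_eq] at h1
    have := hmul p q hpq
    have := hmul' p q hpq
    omega
  -- the configuration in which both halves of `y` cancel against the same `x`
  have hbad : ∀ p q : Fin 2 × Bool, p.1 ≠ q.1 →
      2 * gromov (σ (mk [p]))⁻¹ (σ (mk [q])) = norm (σ (mk [q])) →
      2 * gromov (σ (mk [q]))⁻¹ (σ (mk [p])) = norm (σ (mk [q])) → False := by
    intro p q hpq h1 h2
    have h3 := (hg p q hpq).1
    have hpos : norm (σ (mk [q])) ≠ 0 := fun h => hne q (norm_eq_zero.1 h)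
    set m := gromov (σ (mk [p]))⁻¹ (σ (mk [q])) with hm
    obtain ⟨t, ht, ht'⟩ := exists_suffix (σ (mk [q])) (n := m) (by omega)
    obtain ⟨s, hs, h4, h5⟩ := exists_signedPerm hw hi q p hpq.symm
    have h6 := hmin (MulAut.conj t * (σ * (s * (MulAut.conj (of 0))⁻¹ * transvection)))
      fun h => hmem _ (mul_mem (mul_mem hs (inv_mem (hinn _))) hE)
        ((S.mul_mem_cancel_left (hinn t)).1 h)
    simp only [MulAut.mul_apply, transvection_zero, transvection_one, MulAut.conj_inv_apply,
      _root_.map_mul, _root_.map_inv, h4, h5, MulAut.conj_apply] at h6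
    have h7 := hnorm q p hpq.symm
    set x := σ (mk [p])
    set y := σ (mk [q])
    have e1 : (t * y * t⁻¹)⁻¹ * (t * y * t⁻¹) * (t * y * t⁻¹) = t * (y * t⁻¹) := by group
    have e2 : t * (y * t⁻¹) * ((t * y * t⁻¹)⁻¹ * (t * x * t⁻¹) * (t * y * t⁻¹)) =
        t * (x * (y * t⁻¹)) := by group
    rw [e1, e2] at h6
    set u := y * t⁻¹ with hu
    have e3 : y⁻¹ * u = t⁻¹ := by rw [hu]; group
    have e4 : t⁻¹⁻¹ * y⁻¹ = u⁻¹ := by rw [hu]; group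
    have g1 := norm_add_two_gromov y u
    have g2 := norm_add_two_gromov t⁻¹ y⁻¹
    rw [e3] at g1
    rw [e4] at g2
    have g3 := norm_add_two_gromov x⁻¹ u
    have g4 := norm_add_two_gromov x (x * u)
    have g5 := norm_add_two_gromov t⁻¹ (x * u)
    rw [inv_inv] at g3 g5
    rw [inv_mul_cancel_left] at g4
    simp only [norm_inv_eq] at g1 g2 g3 g4 g5
    have g6 := min_gromov_le x⁻¹ y u
    have g7 := min_gromov_le t⁻¹ y⁻¹ x
    have g8 := min_gromov_le t⁻¹ x (x * u)
    have g9 := norm_mul_le (x * u) u⁻¹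
    rw [mul_inv_cancel_right, norm_inv_eq] at g9
    have g10 := norm_mul_le t u
    omega
  have hred : ∀ L, IsReduced L → L.length ≤ norm (σ (mk L)) := by
    intro L hL
    cases L with
    | nil => simp
    | cons q L =>
      refine le_trans (Nat.le_add_right _ _)
        (length_le_norm_of_nielsen σ.toMonoidHom ?_ q L hL q fun _ => rfl).2
      intro p q r hpq hqr
      simp only [MulEquiv.toMonoidHom_eq_coe, MonoidHom.coe_coe]
      have hself : 2 * gromov (σ (mk [q]))⁻¹ (σ (mk [q])) < norm (σ (mk [q])) :=
        two_gromov_inv_self_lt (hne q)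
      by_cases h1 : p.1 = q.1
      · obtain rfl : p = q := Prod.ext h1 (hpq h1)
        by_cases h2 : p.1 = r.1
        · obtain rfl : p = r := Prod.ext h2 (hqr h2)
          omega
        · have := hg p r h2
          omega
      · by_cases h2 : q.1 = r.1
        · obtain rfl : q = r := Prod.ext h2 (hqr h2)
          have := hg p q h1
          omega
        · have g1 := hg p q h1
          have g2 := hg q r h2
          by_contra! hcon
          have h3 : p.1 = r.1 := by omega
          by_cases h4 : p.2 = r.2
          · obtain rfl : p = r := Prod.ext h3 h4
            exact hbad p q h1 (by omega) (by omega)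
          · have h5 : r = (p.1, !p.2) := Prod.ext h3.symm (Bool.eq_not_of_ne (Ne.symm h4))
            rw [h5, hinv, _root_.map_inv] at hcon g2
            have g3 := min_gromov_le (σ (mk [q]))⁻¹ (σ (mk [p]))⁻¹ (σ (mk [q]))
            omega
  have hletter : ∀ i, ∃ p, σ⁻¹ (of i) = mk [p] := by
    intro i
    have h1 := hred _ (isReduced_toWord (x := σ⁻¹ (of i)))
    rw [mk_toWord, MulAut.apply_inv_self, norm_of] at h1
    have h2 : (σ⁻¹ (of i)).toWord.length ≠ 0 := by
      rw [Ne, List.length_eq_zero_iff, toWord_eq_nil_iff, map_eq_one_iff _ (MulEquiv.injective _)]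
      exact of_ne_one i
    obtain ⟨p, hp⟩ := List.length_eq_one_iff.1 (le_antisymm h1 (Nat.one_le_iff_ne_zero.2 h2))
    exact ⟨p, by rw [← hp, mk_toWord]⟩
  obtain ⟨p, hp⟩ := hletter 0
  obtain ⟨q, hq⟩ := hletter 1
  have hpq : p.1 ≠ q.1 := by
    intro h1
    rcases eq_or_ne p.2 q.2 with h2 | h2
    · have : p = q := Prod.ext h1 h2
      rw [this, ← hq] at hp
      exact absurd (of_injective ((σ⁻¹).injective hp)) (by decide)
    · have : p = (q.1, !q.2) := Prod.ext h1 (Bool.eq_not_of_ne h2)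
      rw [this, hinv, ← hq, ← _root_.map_inv] at hp
      exact absurd ((σ⁻¹).injective hp) (by decide)
  obtain ⟨s, hs, h0, h1⟩ := exists_signedPerm hw hi p q hpq
  have hsσ : σ⁻¹ = s := mulAut_ext fun i => by
    fin_cases i
    · exact hp.trans h0.symm
    · exact hq.trans h1.symm
  exact hσ (inv_mem_iff.1 (hsσ ▸ hs))

end RankTwo

end FreeGroup

/-! ### Automorphisms that act trivially on the abelianization modulo four -/

namespace FreeGroup

/-- The automorphism `a ↦ a`, `b ↦ a² b`. -/
def upperTwist : MulAut (FreeGroup (Fin 2)) :=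
  autOfInverse ![of 0, of 0 * of 0 * of 1] ![of 0, (of 0)⁻¹ * (of 0)⁻¹ * of 1]
    (by simp [Fin.forall_fin_two, mul_assoc]) (by simp [Fin.forall_fin_two, mul_assoc])

/-- The automorphism `a ↦ a b⁻²`, `b ↦ b`. -/
def lowerTwist : MulAut (FreeGroup (Fin 2)) :=
  autOfInverse ![of 0 * (of 1)⁻¹ * (of 1)⁻¹, of 1] ![of 0 * of 1 * of 1, of 1]
    (by simp [Fin.forall_fin_two, mul_assoc]) (by simp [Fin.forall_fin_two, mul_assoc])

@[simp] theorem upperTwist_zero : upperTwist (of 0) = of 0 := by simp [upperTwist]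
@[simp] theorem upperTwist_one : upperTwist (of 1) = of 0 * of 0 * of 1 := by simp [upperTwist]
@[simp] theorem lowerTwist_zero : lowerTwist (of 0) = of 0 * (of 1)⁻¹ * (of 1)⁻¹ := by
  simp [lowerTwist]
@[simp] theorem lowerTwist_one : lowerTwist (of 1) = of 1 := by simp [lowerTwist]

/-- The action of a free group of rank two on another one through the two twists. On
abelianizations the twists become the standard generators of Sanov's subgroup of `SL₂(ℤ)`. -/
def sanovAction : FreeGroup (Fin 2) →* MulAut (FreeGroup (Fin 2)) :=
  lift ![upperTwist, lowerTwist]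

@[simp] theorem sanovAction_zero : sanovAction (of 0) = upperTwist := by simp [sanovAction]
@[simp] theorem sanovAction_one : sanovAction (of 1) = lowerTwist := by simp [sanovAction]

/-- The group of automorphisms generated by the inner ones and the two twists. -/
def innSanov : Subgroup (MulAut (FreeGroup (Fin 2))) := Inn (FreeGroup (Fin 2)) ⊔ sanovAction.range

theorem conj_mem_innSanov (g : FreeGroup (Fin 2)) : MulAut.conj g ∈ innSanov :=
  Subgroup.mem_sup_left ⟨g, rfl⟩

theorem upperTwist_mem_innSanov : upperTwist ∈ innSanov :=
  Subgroup.mem_sup_right ⟨of 0, sanovAction_zero⟩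

theorem lowerTwist_mem_innSanov : lowerTwist ∈ innSanov :=
  Subgroup.mem_sup_right ⟨of 1, sanovAction_one⟩

theorem innSanov_le {S : Subgroup (MulAut (FreeGroup (Fin 2)))}
    (hinn : ∀ g, MulAut.conj g ∈ S) (h0 : upperTwist ∈ S) (h1 : lowerTwist ∈ S) :
    innSanov ≤ S := by
  refine sup_le ?_ ?_
  · rintro _ ⟨g, rfl⟩
    exact hinn g
  · rw [sanovAction, range_lift_eq_closure, Subgroup.closure_le]
    rintro _ ⟨i, rfl⟩
    fin_cases i
    · exact h0
    · exact h1

open scoped Pointwise in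
/-- Every element of the group generated by the inner automorphisms and the twists is the product
of an inner automorphism and an element of the image of the Sanov action. -/
theorem exists_of_mem_innSanov {σ : MulAut (FreeGroup (Fin 2))} (hσ : σ ∈ innSanov) :
    ∃ g γ, σ = MulAut.conj g * sanovAction γ := by
  have : σ ∈ ((Inn (FreeGroup (Fin 2)) : Set (MulAut (FreeGroup (Fin 2)))) *
      (sanovAction.range : Set (MulAut (FreeGroup (Fin 2))))) := by
    rw [← Subgroup.normal_mul]
    exact hσ
  obtain ⟨_, ⟨g, rfl⟩, _, ⟨γ, rfl⟩, rfl⟩ := this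
  exact ⟨g, γ, rfl⟩

theorem swapGens_mul_swapGens : swapGens * swapGens = 1 :=
  mulAut_ext fun i => by fin_cases i <;> simp

theorem invGen_mul_invGen : invGen * invGen = 1 :=
  mulAut_ext fun i => by fin_cases i <;> simp

/-- The group of signed permutations of the two generators. -/
def signedPerms : Subgroup (MulAut (FreeGroup (Fin 2))) := Subgroup.closure {swapGens, invGen}

theorem swapGens_mem : swapGens ∈ signedPerms := Subgroup.subset_closure (by simp)

theorem invGen_mem : invGen ∈ signedPerms := Subgroup.subset_closure (by simp)

theorem signedPerms_le_normalizer :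
    signedPerms ≤ Subgroup.normalizer (innSanov : Set (MulAut (FreeGroup (Fin 2)))) := by
  -- an involution normalizes a subgroup as soon as it conjugates the subgroup into itself
  have key : ∀ s : MulAut (FreeGroup (Fin 2)), s * s = 1 → s * upperTwist * s ∈ innSanov →
      s * lowerTwist * s ∈ innSanov →
      s ∈ Subgroup.normalizer (innSanov : Set (MulAut (FreeGroup (Fin 2)))) := by
    intro s hs h0 h1
    have hinv : s⁻¹ = s := inv_eq_of_mul_eq_one_left hs
    have hle : innSanov ≤ innSanov.comap (MulAut.conj s).toMonoidHom := by
      apply innSanov_le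
      · intro g
        change s * MulAut.conj g * s⁻¹ ∈ innSanov
        exact Subgroup.mem_sup_left ((Inn.normal _).conj_mem _ ⟨g, rfl⟩ s)
      · change s * upperTwist * s⁻¹ ∈ innSanov
        rwa [hinv]
      · change s * lowerTwist * s⁻¹ ∈ innSanov
        rwa [hinv]
    rw [Subgroup.mem_normalizer_iff]
    intro h
    refine ⟨fun hh => hle hh, fun hh => ?_⟩
    have h2 : s * (s * h * s⁻¹) * s⁻¹ ∈ innSanov := hle hh
    rw [hinv] at h2
    have h3 : s * (s * h * s) * s = (s * s) * h * (s * s) := by group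
    rwa [h3, hs, one_mul, mul_one] at h2
  have step : ∀ {x y : MulAut (FreeGroup (Fin 2))}, y ∈ innSanov → x * y ∈ innSanov →
      x ∈ innSanov := fun hy hxy => (innSanov.mul_mem_cancel_right hy).1 hxy
  rw [signedPerms, Subgroup.closure_le]
  rintro s (rfl | rfl)
  · refine key _ swapGens_mul_swapGens (step lowerTwist_mem_innSanov ?_)
      (step upperTwist_mem_innSanov ?_)
    · convert conj_mem_innSanov (of 1 * of 1) using 1
      refine mulAut_ext fun i => ?_
      fin_cases i <;> simp [mul_assoc]
    · convert conj_mem_innSanov (of 0 * of 0) using 1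
      refine mulAut_ext fun i => ?_
      fin_cases i <;> simp [mul_assoc]
  · refine key _ invGen_mul_invGen (step upperTwist_mem_innSanov ?_)
      (step lowerTwist_mem_innSanov ?_)
    · convert one_mem innSanov using 1
      refine mulAut_ext fun i => ?_
      fin_cases i <;> simp [mul_assoc]
    · convert conj_mem_innSanov (of 1 * of 1) using 1
      refine mulAut_ext fun i => ?_
      fin_cases i <;> simp [mul_assoc]

/-- The coset decomposition of `Aut F₂` modulo the group generated by the inner automorphisms, the
twists and the signed permutations: this group has index three, as the preimage of a subgroup of
order two of `GL₂(𝔽₂) ≅ S₃`. -/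
theorem exists_coset_representative (σ : MulAut (FreeGroup (Fin 2))) :
    ∃ r ∈ ({1, transvection, transvection * swapGens} : Set (MulAut (FreeGroup (Fin 2)))),
      σ * r⁻¹ ∈ signedPerms ⊔ innSanov := by
  set D := signedPerms ⊔ innSanov
  have hw : swapGens ∈ D := Subgroup.mem_sup_left swapGens_mem
  have hi : invGen ∈ D := Subgroup.mem_sup_left invGen_mem
  have hα : upperTwist ∈ D := Subgroup.mem_sup_right upperTwist_mem_innSanov
  have hconj : ∀ g, MulAut.conj g ∈ D := fun g => Subgroup.mem_sup_right (conj_mem_innSanov g)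
  have step : ∀ x : MulAut (FreeGroup (Fin 2)), ∀ r g d r' : MulAut (FreeGroup (Fin 2)),
      x * r⁻¹ ∈ D → d ∈ D → r * g = d * r' → (x * g) * r'⁻¹ ∈ D := by
    intro x r g d r' hx hd h
    have : x * g * r'⁻¹ = (x * r⁻¹) * (r * g * r'⁻¹) := by group
    rw [this, h, mul_inv_cancel_right]
    exact mul_mem hx hd
  let P : MulAut (FreeGroup (Fin 2)) → Prop := fun x =>
    ∃ r ∈ ({1, transvection, transvection * swapGens} : Set (MulAut (FreeGroup (Fin 2)))),
      x * r⁻¹ ∈ D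
  have hPw : ∀ x, P x → P (x * swapGens) := by
    rintro x ⟨r, (rfl | rfl | rfl), hx⟩
    · exact ⟨1, by simp, step _ _ _ _ _ hx hw (by simp)⟩
    · exact ⟨transvection * swapGens, by simp, step _ _ _ _ _ hx (one_mem D) (by simp)⟩
    · exact ⟨transvection, by simp, step _ _ _ _ _ hx (one_mem D)
        (by rw [mul_assoc, swapGens_mul_swapGens, mul_one, one_mul])⟩
  have hPi : ∀ x, P x → P (x * invGen) := by
    rintro x ⟨r, (rfl | rfl | rfl), hx⟩
    · exact ⟨1, by simp, step _ _ _ _ _ hx hi (by simp)⟩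
    · refine ⟨transvection, by simp, step _ _ _ _ _ hx (mul_mem hα hi) (mulAut_ext fun i => ?_)⟩
      fin_cases i <;> simp [mul_assoc]
    · refine ⟨transvection * swapGens, by simp, step _ _ _ _ _ hx
        (mul_mem (mul_mem (hconj (of 0)⁻¹) hα) (mul_mem (mul_mem hw hi) hw))
        (mulAut_ext fun i => ?_)⟩
      fin_cases i <;> simp [mul_assoc]
  have hPE : ∀ x, P x → P (x * transvection) := by
    rintro x ⟨r, (rfl | rfl | rfl), hx⟩
    · exact ⟨transvection, by simp, step _ _ _ _ _ hx (one_mem D) (by simp)⟩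
    · refine ⟨1, by simp, step _ _ _ _ _ hx hα (mulAut_ext fun i => ?_)⟩
      fin_cases i <;> simp [mul_assoc]
    · refine ⟨transvection * swapGens, by simp, step _ _ _ _ _ hx
        (mul_mem (mul_mem (hconj (of 0)⁻¹) hα) (mul_mem hi hw)) (mulAut_ext fun i => ?_)⟩
      fin_cases i <;> simp [mul_assoc]
  have hPc : ∀ g x, P x → P (x * MulAut.conj g) := by
    rintro g x ⟨r, hr, hx⟩
    refine ⟨r, hr, step _ _ _ _ _ hx (hconj (r g)) ?_⟩
    ext
    simp
  have hEinv : transvection⁻¹ = invGen * transvection * invGen := by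
    rw [inv_eq_iff_mul_eq_one]
    refine mulAut_ext fun i => ?_
    fin_cases i <;> simp
  let S : Subgroup (MulAut (FreeGroup (Fin 2))) :=
    Subgroup.closure ({transvection, swapGens, invGen} ∪ Set.range MulAut.conj)
  have hσ : σ ∈ S := mulAut_mem_of_generators
    (fun g => Subgroup.subset_closure (Or.inr ⟨g, rfl⟩))
    (Subgroup.subset_closure (by simp)) (Subgroup.subset_closure (by simp))
    (Subgroup.subset_closure (by simp)) σ
  change P σ
  induction hσ using Subgroup.closure_induction_right with
  | one => exact ⟨1, by simp, by simp⟩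
  | mul_right x _ y hy hx =>
    rcases hy with (rfl | rfl | rfl) | ⟨g, rfl⟩
    exacts [hPE _ hx, hPw _ hx, hPi _ hx, hPc _ _ hx]
  | mul_inv_cancel x _ y hy hx =>
    rcases hy with (rfl | rfl | rfl) | ⟨g, rfl⟩
    · rw [hEinv, ← mul_assoc, ← mul_assoc]
      exact hPi _ (hPE _ (hPi _ hx))
    · rw [inv_eq_of_mul_eq_one_left swapGens_mul_swapGens]
      exact hPw _ hx
    · rw [inv_eq_of_mul_eq_one_left invGen_mul_invGen]
      exact hPi _ hx
    · rw [← _root_.map_inv]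
      exact hPc _ _ hx

/-- The exponent sum of the `i`-th generator, modulo four. -/
def expSum (i : Fin 2) : FreeGroup (Fin 2) →* Multiplicative (ZMod 4) :=
  lift fun j => Multiplicative.ofAdd (if j = i then 1 else 0)

theorem toAdd_expSum_of (i j : Fin 2) :
    (expSum i (of j)).toAdd = if j = i then 1 else 0 := by
  simp [expSum]

/-- The automorphisms whose action on the abelianization modulo four has the shape
`[1, 2m; 2n, 1]`. -/
def levelFour : Subgroup (MulAut (FreeGroup (Fin 2))) where
  carrier := {σ | ∃ m n : ZMod 4, ∀ x,
    (expSum 0 (σ x)).toAdd = (expSum 0 x).toAdd + 2 * m * (expSum 1 x).toAdd ∧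
    (expSum 1 (σ x)).toAdd = 2 * n * (expSum 0 x).toAdd + (expSum 1 x).toAdd}
  one_mem' := ⟨0, 0, fun x => by simp⟩
  mul_mem' := by
    rintro σ τ ⟨m, n, h⟩ ⟨m', n', h'⟩
    have h4 : (4 : ZMod 4) = 0 := rfl
    refine ⟨m + m', n + n', fun x => ?_⟩
    rw [MulAut.mul_apply, (h _).1, (h _).2, (h' _).1, (h' _).2]
    constructor
    · linear_combination (m * n' * (expSum 0 x).toAdd) * h4
    · linear_combination (m' * n * (expSum 1 x).toAdd) * h4
  inv_mem' := by
    rintro σ ⟨m, n, h⟩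
    have h4 : (4 : ZMod 4) = 0 := rfl
    refine ⟨-m, -n, fun x => ?_⟩
    have h1 := h (σ⁻¹ x)
    rw [MulAut.apply_inv_self] at h1
    rw [h1.1, h1.2]
    constructor
    · linear_combination (m * n * (expSum 0 (σ⁻¹ x)).toAdd) * h4
    · linear_combination (m * n * (expSum 1 (σ⁻¹ x)).toAdd) * h4

theorem innSanov_le_levelFour : innSanov ≤ levelFour := by
  apply innSanov_le
  · intro g
    exact ⟨0, 0, fun x => by simp⟩
  · refine ⟨1, 0, fun x => ?_⟩
    induction x using FreeGroup.induction_on with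
    | C1 => simp
    | of i => fin_cases i <;> simp [expSum, one_add_one_eq_two]
    | inv_of i h => simp only [_root_.map_inv, toAdd_inv, h.1, h.2]; constructor <;> ring
    | mul x y hx hy =>
      simp only [_root_.map_mul, toAdd_mul, hx.1, hx.2, hy.1, hy.2]; constructor <;> ring
  · refine ⟨0, -1, fun x => ?_⟩
    induction x using FreeGroup.induction_on with
    | C1 => simp
    | of i => fin_cases i <;> simp [expSum]; decide
    | inv_of i h => simp only [_root_.map_inv, toAdd_inv, h.1, h.2]; constructor <;> ring
    | mul x y hx hy =>
      simp only [_root_.map_mul, toAdd_mul, hx.1, hx.2, hy.1, hy.2]; constructor <;> ring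

theorem exists_letters_of_mem_signedPerms {s : MulAut (FreeGroup (Fin 2))} (hs : s ∈ signedPerms) :
    ∃ p q : Fin 2 × Bool, s (of 0) = mk [p] ∧ s (of 1) = mk [q] := by
  have hinv : ∀ p : Fin 2 × Bool, (mk [p])⁻¹ = mk [(p.1, !p.2)] := fun p => by
    simp [inv_mk, invRev]
  have hw : ∀ x : MulAut (FreeGroup (Fin 2)),
      (∃ p q : Fin 2 × Bool, x (of 0) = mk [p] ∧ x (of 1) = mk [q]) →
      ∃ p q : Fin 2 × Bool, (x * swapGens) (of 0) = mk [p] ∧ (x * swapGens) (of 1) = mk [q] := by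
    rintro x ⟨p, q, hp, hq⟩
    exact ⟨q, p, by simpa using hq, by simpa using hp⟩
  have hi : ∀ x : MulAut (FreeGroup (Fin 2)),
      (∃ p q : Fin 2 × Bool, x (of 0) = mk [p] ∧ x (of 1) = mk [q]) →
      ∃ p q : Fin 2 × Bool, (x * invGen) (of 0) = mk [p] ∧ (x * invGen) (of 1) = mk [q] := by
    rintro x ⟨p, q, hp, hq⟩
    exact ⟨(p.1, !p.2), q, by rw [← hinv, ← hp]; simp, by simpa using hq⟩
  induction hs using Subgroup.closure_induction_right with
  | one => exact ⟨(0, true), (1, true), rfl, rfl⟩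
  | mul_right x _ y hy hx =>
    rcases hy with rfl | rfl
    exacts [hw x hx, hi x hx]
  | mul_inv_cancel x _ y hy hx =>
    rcases hy with rfl | rfl
    · rw [inv_eq_of_mul_eq_one_left swapGens_mul_swapGens]
      exact hw x hx
    · rw [inv_eq_of_mul_eq_one_left invGen_mul_invGen]
      exact hi x hx

/-- An automorphism of the free group of rank two that acts trivially on the abelianization modulo
four is, up to an inner automorphism, a product of the two twists. -/
theorem exists_eq_conj_mul_sanovAction {σ : MulAut (FreeGroup (Fin 2))}
    (hσ : ∀ i x, expSum i (σ x) = expSum i x) : ∃ g γ, σ = MulAut.conj g * sanovAction γ := by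
  apply exists_of_mem_innSanov
  obtain ⟨r, hr, hD⟩ := exists_coset_representative σ
  rw [← SetLike.mem_coe, Subgroup.coe_mul_of_left_le_normalizer_right _ _
    signedPerms_le_normalizer] at hD
  obtain ⟨s, hs, b, hb, hsb⟩ := hD
  obtain ⟨p, q, hp, hq⟩ := exists_letters_of_mem_signedPerms hs
  obtain ⟨m, n, hmn⟩ := innSanov_le_levelFour (inv_mem hb)
  have hs' : ∀ x, s x = σ (r⁻¹ (b⁻¹ x)) := by
    intro x
    have := congrArg (fun τ : MulAut (FreeGroup (Fin 2)) => τ (b⁻¹ x)) hsb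
    simpa using this
  have e0 : ∀ i, expSum i (mk [p]) = expSum i (r⁻¹ (b⁻¹ (of 0))) := fun i => by
    rw [← hp, hs', hσ]
  have e1 : ∀ i, expSum i (mk [q]) = expSum i (r⁻¹ (b⁻¹ (of 1))) := fun i => by
    rw [← hq, hs', hσ]
  -- exponent sums of a letter
  have hletter : ∀ p : Fin 2 × Bool, ∀ i, (expSum i (mk [p])).toAdd =
      if p.1 = i then (if p.2 then 1 else -1) else 0 := by
    rintro ⟨j, _ | _⟩ i <;> by_cases h : j = i <;> simp [expSum, h]
  have hEinv : transvection⁻¹ (of 0) = of 0 ∧ transvection⁻¹ (of 1) = (of 0)⁻¹ * of 1 := by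
    constructor <;> rw [MulAut.inv_apply, MulEquiv.symm_apply_eq] <;> simp
  have hE : ∀ x, (expSum 0 (transvection⁻¹ x)).toAdd =
      (expSum 0 x).toAdd - (expSum 1 x).toAdd ∧
      (expSum 1 (transvection⁻¹ x)).toAdd = (expSum 1 x).toAdd := by
    intro x
    induction x using FreeGroup.induction_on with
    | C1 => simp
    | of i => fin_cases i <;> simp [hEinv, toAdd_expSum_of]
    | inv_of i h => exact ⟨by simp only [_root_.map_inv, toAdd_inv, h.1]; ring,
        by simp only [_root_.map_inv, toAdd_inv, h.2]⟩
    | mul x y hx hy =>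
      exact ⟨by simp only [_root_.map_mul, toAdd_mul, hx.1, hy.1]; ring,
        by simp only [_root_.map_mul, toAdd_mul, hx.2, hy.2]⟩
  have hw : ∀ x, expSum 0 (swapGens⁻¹ x) = expSum 1 x ∧ expSum 1 (swapGens⁻¹ x) = expSum 0 x := by
    intro x
    rw [inv_eq_of_mul_eq_one_left swapGens_mul_swapGens]
    induction x using FreeGroup.induction_on with
    | C1 => simp
    | of i => fin_cases i <;> simp [expSum]
    | inv_of i h => simp only [_root_.map_inv, h.1, h.2, and_self]
    | mul x y hx hy => simp only [_root_.map_mul, hx.1, hx.2, hy.1, hy.2, and_self]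
  have b0 := hmn (of 0)
  have b1 := hmn (of 1)
  simp only [toAdd_expSum_of, Fin.isValue, zero_ne_one, one_ne_zero, if_true, if_false, mul_zero,
    mul_one, add_zero, zero_add] at b0 b1
  have f0 := fun i => congrArg Multiplicative.toAdd (e0 i)
  have f1 := fun i => congrArg Multiplicative.toAdd (e1 i)
  simp only [hletter] at f0 f1
  have f00 := f0 0
  have f01 := f0 1
  have f10 := f1 0
  have f11 := f1 1
  clear e0 e1 f0 f1
  rcases hr with rfl | rfl | rfl
  · simp only [inv_one, MulAut.one_apply, b0, b1] at f00 f01 f10 f11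
    have hp' : p = (0, true) := by
      clear f10 f11 hp hs' b0 hmn
      revert p n
      decide
    have hq' : q = (1, true) := by
      clear f00 f01 hq hs' b1 hmn
      revert q m
      decide
    have hs1 : s = 1 := mulAut_ext fun i => by
      fin_cases i
      · exact hp.trans (by rw [hp']; rfl)
      · exact hq.trans (by rw [hq']; rfl)
    rw [inv_one, mul_one] at hsb
    rw [← hsb, hs1]
    simpa using hb
  · exfalso
    rw [(hE _).1, b1.1, b1.2] at f10
    rw [(hE _).2, b1.2] at f11
    clear hq hs' b1 hmn f00 f01
    revert q m
    decide
  · exfalso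
    rw [mul_inv_rev, MulAut.mul_apply, (hw _).1, (hE _).2, b1.2] at f10
    rw [mul_inv_rev, MulAut.mul_apply, (hw _).2, (hE _).1, b1.1, b1.2] at f11
    clear hq hs' b1 hmn f00 f01
    revert q m
    decide

end FreeGroup

/-! ### Centralizers in finite quotients of free groups -/

namespace FreeGroup

/-- A finite shadow of the fact that the square of a basis element of a free profinite group has
the closed subgroup generated by that element as its centralizer: every finite quotient `f` is
dominated by a finite quotient `F` in which anything commuting with the square of the basis element
`x₀` maps under `f` into the subgroup generated by `x₀`. The group `F` maps to is the wreath product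
of `ℤ/3` and the image of `f` over the cosets of that subgroup. -/
theorem exists_finite_quotient_commute_sq {X Q : Type} [Group Q] [Finite Q] (f : FreeGroup X →* Q)
    (x₀ : X) : ∃ (E : Type) (_ : Group E) (_ : Finite E) (F : FreeGroup X →* E),
      ∀ w, F w * F (of x₀) ^ 2 = F (of x₀) ^ 2 * F w → f w ∈ Subgroup.zpowers (f (of x₀)) := by
  classical
  let Y := Q ⧸ Subgroup.zpowers (f (of x₀))
  let A := Y → Multiplicative (ZMod 3)
  let E := A ⋊[(mulAutArrow : Q →* MulAut A)] Q
  let y₀ : Y := ((1 : Q) : Y)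
  let δ : A := Pi.mulSingle y₀ (Multiplicative.ofAdd 1)
  let F : FreeGroup X →* E := lift fun x => ⟨if x = x₀ then δ else 1, f (of x)⟩
  have hright : ∀ w, (F w).right = f w := by
    intro w
    have : SemidirectProduct.rightHom.comp F = f := by ext x; simp [F]
    exact DFunLike.congr_fun this w
  have hE : Finite E := Finite.of_equiv _ SemidirectProduct.equivProd.symm
  refine ⟨E, inferInstance, hE, F, fun w hw => ?_⟩
  have hF : F (of x₀) = ⟨δ, f (of x₀)⟩ := by simp [F]
  have hfix : ∀ q ∈ Subgroup.zpowers (f (of x₀)), q • y₀ = y₀ := by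
    intro q hq
    change ((q * 1 : Q) : Y) = ((1 : Q) : Y)
    rw [mul_one, eq_comm, QuotientGroup.eq]
    simpa using hq
  have hc := Subgroup.mem_zpowers (f (of x₀))
  have hmul : ∀ e e' : E, ∀ y, (e * e').left y = e.left y * e'.left (e.right⁻¹ • y) :=
    fun _ _ _ => rfl
  have hδ : δ y₀ = Multiplicative.ofAdd 1 := by simp [δ]
  -- compare the coefficients at the base coset, which the basis element fixes
  have h1 : (F w * F (of x₀) ^ 2).left y₀ = (F (of x₀) ^ 2 * F w).left y₀ := by rw [hw]
  rw [pow_two, hmul, hmul, hmul, hmul, hF, SemidirectProduct.mul_right, hright] at h1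
  simp only [hfix _ (inv_mem hc), hfix _ (inv_mem (mul_mem hc hc)), hδ] at h1
  by_cases hw0 : (f w)⁻¹ • y₀ = y₀
  · have h3 : (((f w)⁻¹ * 1 : Q) : Y) = ((1 : Q) : Y) := hw0
    rw [mul_one, QuotientGroup.eq] at h3
    simpa using h3
  · exfalso
    have hw1 : (f (of x₀))⁻¹ • (f w)⁻¹ • y₀ ≠ y₀ := by
      rw [Ne, inv_smul_eq_iff, hfix _ hc]
      exact hw0
    have h4 : δ ((f w)⁻¹ • y₀) = 1 := Pi.mulSingle_eq_of_ne hw0 _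
    have h5 : δ ((f (of x₀))⁻¹ • (f w)⁻¹ • y₀) = 1 := Pi.mulSingle_eq_of_ne hw1 _
    rw [h4, h5, mul_one, mul_comm] at h1
    exact absurd (mul_right_cancel h1) (by decide)

/-- Every finite quotient `f` of the free group of rank two is dominated by a finite quotient `F` in
which anything commuting with the squares of both generators dies under `f`. -/
theorem exists_finite_quotient_commute_sq_sq {Q : Type} [Group Q] [Finite Q]
    (f : FreeGroup (Fin 2) →* Q) :
    ∃ (E : Type) (_ : Group E) (_ : Finite E) (F : FreeGroup (Fin 2) →* E),
      ∀ w, (∀ i, F w * F (of i) ^ 2 = F (of i) ^ 2 * F w) → f w = 1 := by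
  have : NeZero (Nat.card Q) := ⟨Nat.card_pos.ne'⟩
  -- recording the exponent of the first generator separates the two cyclic subgroups
  let e : FreeGroup (Fin 2) →* Multiplicative (ZMod (Nat.card Q)) :=
    lift ![Multiplicative.ofAdd 1, 1]
  have hfin : Finite (Multiplicative (ZMod (Nat.card Q))) :=
    inferInstanceAs (Finite (ZMod (Nat.card Q)))
  obtain ⟨E₀, _, _, F₀, h₀⟩ := exists_finite_quotient_commute_sq (f.prod e) 0
  obtain ⟨E₁, _, _, F₁, h₁⟩ := exists_finite_quotient_commute_sq (f.prod e) 1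
  refine ⟨E₀ × E₁, inferInstance, inferInstance, F₀.prod F₁, fun w hw => ?_⟩
  obtain ⟨k, hk⟩ := Subgroup.mem_zpowers_iff.1 (h₀ w (congrArg Prod.fst (hw 0)))
  obtain ⟨l, hl⟩ := Subgroup.mem_zpowers_iff.1 (h₁ w (congrArg Prod.snd (hw 1)))
  have hk1 : f (of 0) ^ k = f w := congrArg Prod.fst hk
  have hk2 : e (of 0) ^ k = e w := congrArg Prod.snd hk
  have hl2 : e (of 1) ^ l = e w := congrArg Prod.snd hl
  simp only [e, lift_apply_of, Matrix.cons_val_zero, Matrix.cons_val_one, one_zpow] at hk2 hl2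
  rw [← hl2, ← ofAdd_zsmul, ofAdd_eq_one, zsmul_one, ZMod.intCast_zmod_eq_zero_iff_dvd] at hk2
  rw [← hk1]
  obtain ⟨m, rfl⟩ := hk2
  rw [zpow_mul, zpow_natCast, pow_card_eq_one', one_zpow]

/-- The intersection of the kernels of all homomorphisms from `G` to a group `E`. -/
def homKernel (G E : Type*) [Group G] [Group E] : Subgroup G := ⨅ f : G →* E, f.ker

instance homKernel_characteristic (G E : Type*) [Group G] [Group E] :
    (homKernel G E).Characteristic := by
  rw [Subgroup.characteristic_iff_le_comap]
  intro φ x hx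
  simp only [homKernel, Subgroup.mem_comap, Subgroup.mem_iInf, MonoidHom.mem_ker] at hx ⊢
  exact fun f => hx (f.comp φ.toMonoidHom)

instance homKernel_finiteIndex (X E : Type*) [Finite X] [Group E] [Finite E] :
    (homKernel (FreeGroup X) E).FiniteIndex := by
  have : Finite (FreeGroup X →* E) := Finite.of_equiv _ (lift (α := X) (β := E))
  exact Subgroup.finiteIndex_iInf fun f => inferInstance

end FreeGroup

/-! ### A cocycle from the once-punctured torus to the four-punctured sphere -/

namespace FreeGroup

/-- The Klein four-group, written multiplicatively. -/
abbrev Klein : Type := Multiplicative (ZMod 2 × ZMod 2)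

/-- The function on the Klein four-group with the four given values, listed in the order
`(0,0), (1,0), (0,1), (1,1)`. -/
def kleinFun {T : Type*} (t₀ t₁ t₂ t₃ : T) (v : Klein) : T :=
  !![t₀, t₂; t₁, t₃] v.toAdd.1 v.toAdd.2

/-- The element `(i, j)` of the Klein four-group. -/
def kleinElt (i j : ZMod 2) : Klein := Multiplicative.ofAdd (i, j)

theorem klein_one : (1 : Klein) = kleinElt 0 0 := rfl

theorem kleinElt_mul (i j k l : ZMod 2) :
    kleinElt i j * kleinElt k l = kleinElt (i + k) (j + l) := rfl

theorem kleinElt_inv (i j : ZMod 2) : (kleinElt i j)⁻¹ = kleinElt i j := by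
  revert i j
  decide

section

variable {T : Type*} (t₀ t₁ t₂ t₃ : T)

theorem kleinFun_zero_zero : kleinFun t₀ t₁ t₂ t₃ (kleinElt 0 0) = t₀ := rfl

theorem kleinFun_one_zero : kleinFun t₀ t₁ t₂ t₃ (kleinElt 1 0) = t₁ := rfl

theorem kleinFun_zero_one : kleinFun t₀ t₁ t₂ t₃ (kleinElt 0 1) = t₂ := rfl

theorem kleinFun_one_one : kleinFun t₀ t₁ t₂ t₃ (kleinElt 1 1) = t₃ := rfl

variable {t₀ t₁ t₂ t₃} in
theorem kleinFun_induction {P : T → Prop} (h₀ : P t₀) (h₁ : P t₁) (h₂ : P t₂) (h₃ : P t₃)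
    (v : Klein) : P (kleinFun t₀ t₁ t₂ t₃ v) := by
  obtain ⟨i, j⟩ := v
  fin_cases i <;> fin_cases j
  exacts [h₀, h₂, h₁, h₃]

end

theorem zmod_two_one_add_one : (1 : ZMod 2) + 1 = 0 := rfl

theorem wreath_ext_klein {T : Type*} {x y : RegularWreathProduct T Klein} (hr : x.right = y.right)
    (h00 : x.left (kleinElt 0 0) = y.left (kleinElt 0 0))
    (h10 : x.left (kleinElt 1 0) = y.left (kleinElt 1 0))
    (h01 : x.left (kleinElt 0 1) = y.left (kleinElt 0 1))
    (h11 : x.left (kleinElt 1 1) = y.left (kleinElt 1 1)) : x = y := by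
  refine RegularWreathProduct.ext (funext fun v => ?_) hr
  obtain ⟨i, j⟩ := v
  fin_cases i <;> fin_cases j
  exacts [h00, h01, h10, h11]

section Cocycle

variable {T : Type*} [Group T]

/-- The homomorphism from `F₂ = ⟨a, b⟩` to the wreath product of a group `T` by the Klein four-group
`V` that describes the four-punctured sphere as a covering of an orbifold. Let
`Σ = ⟨s₁, s₂, s₃ | sᵢ²⟩`, with `a = s₁ s₂` and `b = s₂ s₃`. The kernel of the map `Σ → V` sending
`s₁, s₂, s₃` to `(1,0), (0,1), (1,1)` is free on `c = s₁ s₂ s₃`, `p = s₂ s₃ s₁`, `q = s₃ s₁ s₂`,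
and `1, s₁, s₂, s₃` represent its cosets. The values on `a` and `b` record how these
permute the cosets. -/
def sphereCocycle (c p q : T) : FreeGroup (Fin 2) →* RegularWreathProduct T Klein :=
  lift ![⟨kleinFun c 1 (c * q)⁻¹ q, kleinElt 1 1⟩, ⟨kleinFun p c 1 (p * c)⁻¹, kleinElt 1 0⟩]

/-- The diagonal elements of the wreath product through which the twists act on
`sphereCocycle`. -/
def sphereDiag (c p q α β : T) : FreeGroup (Fin 2) →* RegularWreathProduct T Klein :=
  lift ![⟨kleinFun α ((c * q)⁻¹ * α) ((c * q)⁻¹ * α) α, 1⟩,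
    ⟨kleinFun β β ((p * c)⁻¹ * β) ((p * c)⁻¹ * β), 1⟩]

theorem sphereDiag_right (c p q α β : T) (γ : FreeGroup (Fin 2)) :
    (sphereDiag c p q α β γ).right = 1 := by
  have : RegularWreathProduct.rightHom.comp (sphereDiag c p q α β) = 1 := by
    ext i : 1
    fin_cases i <;> simp [sphereDiag]
  exact DFunLike.congr_fun this γ

theorem sphereDiag_left_one (c p q α β : T) (γ : FreeGroup (Fin 2)) :
    (sphereDiag c p q α β γ).left 1 = lift ![α, β] γ := by
  induction γ using FreeGroup.induction_on with
  | C1 => simp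
  | of i => fin_cases i <;> simp [sphereDiag] <;> rfl
  | inv_of i h =>
    rw [_root_.map_inv, _root_.map_inv, RegularWreathProduct.inv_left, ← h]
    simp only [sphereDiag_right, Pi.inv_apply, one_mul]
  | mul x y hx hy =>
    rw [_root_.map_mul, _root_.map_mul, RegularWreathProduct.mul_left, Pi.mul_apply,
      sphereDiag_right, inv_one, mul_one, hx, hy]

/-- The cocycle intertwines the Sanov action with conjugation, provided `α` and `β` act on
`c, p, q` as the generators of the pure mapping class group of the four-punctured sphere do. -/
theorem sphereCocycle_sanovAction {c p q α β : T} (hαc : Commute α c) (hαq : Commute α q)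
    (hαp : Commute ((c * q)⁻¹ * α) p) (hβc : Commute β c) (hβp : Commute β p)
    (hβq : Commute ((p * c)⁻¹ * β) q) (γ x : FreeGroup (Fin 2)) :
    sphereCocycle c p q (sanovAction γ x) =
      sphereDiag c p q α β γ * sphereCocycle c p q x * (sphereDiag c p q α β γ)⁻¹ := by
  have hαcq : Commute ((c * q)⁻¹ * α) (c * q) :=
    ((Commute.refl (c * q)).inv_left).mul_left (hαc.mul_right hαq)
  have hβpc : Commute ((p * c)⁻¹ * β) (p * c) :=
    ((Commute.refl (p * c)).inv_left).mul_left (hβp.mul_right hβc)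
  have ha : sphereCocycle c p q (of 0) = ⟨kleinFun c 1 (c * q)⁻¹ q, kleinElt 1 1⟩ := by
    simp [sphereCocycle]
  have hb : sphereCocycle c p q (of 1) = ⟨kleinFun p c 1 (p * c)⁻¹, kleinElt 1 0⟩ := by
    simp [sphereCocycle]
  have hk0 : sphereDiag c p q α β (of 0) =
      ⟨kleinFun α ((c * q)⁻¹ * α) ((c * q)⁻¹ * α) α, 1⟩ := by simp [sphereDiag]
  have hk1 : sphereDiag c p q α β (of 1) =
      ⟨kleinFun β β ((p * c)⁻¹ * β) ((p * c)⁻¹ * β), 1⟩ := by simp [sphereDiag]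
  have h0 : ∀ x, sphereCocycle c p q (upperTwist x) =
      MulAut.conj (sphereDiag c p q α β (of 0)) (sphereCocycle c p q x) := by
    suffices h : (sphereCocycle c p q).comp upperTwist.toMonoidHom =
        (MulAut.conj (sphereDiag c p q α β (of 0))).toMonoidHom.comp (sphereCocycle c p q) from
      DFunLike.congr_fun h
    ext i : 1
    fin_cases i
    · change sphereCocycle c p q (upperTwist (of 0)) =
        sphereDiag c p q α β (of 0) * sphereCocycle c p q (of 0) * (sphereDiag c p q α β (of 0))⁻¹
      rw [eq_mul_inv_iff_mul_eq, upperTwist_zero, ha, hk0]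
      refine wreath_ext_klein ?_ ?_ ?_ ?_ ?_ <;>
      simp only [RegularWreathProduct.mul_left, RegularWreathProduct.mul_right,
        Pi.mul_apply, klein_one, kleinElt_mul, kleinElt_inv, zmod_two_one_add_one, add_zero,
        zero_add,
        kleinFun_zero_zero, kleinFun_one_zero, kleinFun_zero_one, kleinFun_one_one]
      · exact hαc.eq.symm
      · simp
      · exact hαcq.inv_right.eq.symm
      · exact hαq.eq.symm
    · change sphereCocycle c p q (upperTwist (of 1)) =
        sphereDiag c p q α β (of 0) * sphereCocycle c p q (of 1) * (sphereDiag c p q α β (of 0))⁻¹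
      rw [eq_mul_inv_iff_mul_eq, upperTwist_one, _root_.map_mul, _root_.map_mul, ha, hb, hk0]
      refine wreath_ext_klein ?_ ?_ ?_ ?_ ?_ <;>
      simp only [RegularWreathProduct.mul_left, RegularWreathProduct.mul_right,
        Pi.mul_apply, klein_one, kleinElt_mul, kleinElt_inv, zmod_two_one_add_one, add_zero,
        zero_add,
        kleinFun_zero_zero, kleinFun_one_zero, kleinFun_zero_one, kleinFun_one_one]
      · rw [mul_assoc, ← hαp.eq]
        group
      · rw [mul_assoc _ α, hαc.eq]
        group
      · simp
      · have e1 : q * c * (p * c)⁻¹ * ((c * q)⁻¹ * α) = q * (p⁻¹ * ((c * q)⁻¹ * α)) := by group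
        have e2 : q * ((c * q)⁻¹ * α * p⁻¹) = c⁻¹ * α * p⁻¹ := by group
        rw [e1, ← hαp.inv_right.eq, e2, ← hαc.inv_right.eq, mul_inv_rev, mul_assoc]
  have h1 : ∀ x, sphereCocycle c p q (lowerTwist x) =
      MulAut.conj (sphereDiag c p q α β (of 1)) (sphereCocycle c p q x) := by
    suffices h : (sphereCocycle c p q).comp lowerTwist.toMonoidHom =
        (MulAut.conj (sphereDiag c p q α β (of 1))).toMonoidHom.comp (sphereCocycle c p q) from
      DFunLike.congr_fun h
    ext i : 1
    fin_cases i
    · change sphereCocycle c p q (lowerTwist (of 0)) =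
        sphereDiag c p q α β (of 1) * sphereCocycle c p q (of 0) * (sphereDiag c p q α β (of 1))⁻¹
      rw [eq_mul_inv_iff_mul_eq, lowerTwist_zero, _root_.map_mul, _root_.map_mul, _root_.map_inv,
        ha, hb, hk1]
      refine wreath_ext_klein ?_ ?_ ?_ ?_ ?_ <;>
      simp only [RegularWreathProduct.mul_left, RegularWreathProduct.mul_right,
        RegularWreathProduct.inv_left, RegularWreathProduct.inv_right, Pi.mul_apply, Pi.inv_apply,
        klein_one, kleinElt_mul, kleinElt_inv, zmod_two_one_add_one, add_zero, zero_add,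
        kleinFun_zero_zero, kleinFun_one_zero, kleinFun_zero_one, kleinFun_one_one]
      · rw [hβc.eq]
        group
      · group
      · have e1 : (p * c)⁻¹ * β * (c * q)⁻¹ = (p * c)⁻¹ * β * q⁻¹ * c⁻¹ := by group
        have e2 : q⁻¹ * ((p * c)⁻¹ * β) * c⁻¹ = q⁻¹ * (p * c)⁻¹ * (β * c⁻¹) := by group
        rw [e1, hβq.inv_right.eq, e2, hβc.inv_right.eq]
        group
      · rw [hβq.eq]
        group
    · change sphereCocycle c p q (lowerTwist (of 1)) =
        sphereDiag c p q α β (of 1) * sphereCocycle c p q (of 1) * (sphereDiag c p q α β (of 1))⁻¹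
      rw [eq_mul_inv_iff_mul_eq, lowerTwist_one, hb, hk1]
      refine wreath_ext_klein ?_ ?_ ?_ ?_ ?_ <;>
      simp only [RegularWreathProduct.mul_left, RegularWreathProduct.mul_right,
        Pi.mul_apply, klein_one, kleinElt_mul, kleinElt_inv, zmod_two_one_add_one, add_zero,
        zero_add,
        kleinFun_zero_zero, kleinFun_one_zero, kleinFun_zero_one, kleinFun_one_one]
      · exact hβp.eq.symm
      · exact hβc.eq.symm
      · simp
      · exact hβpc.inv_right.eq.symm
  induction γ using FreeGroup.induction_on generalizing x with
  | C1 => simp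
  | of i => fin_cases i <;> simp [h0, h1]
  | inv_of i h =>
    have := h (sanovAction (of i)⁻¹ x)
    rw [← MulAut.mul_apply, ← _root_.map_mul, mul_inv_cancel, _root_.map_one,
      MulAut.one_apply] at this
    rw [this, _root_.map_inv (sphereDiag c p q α β)]
    group
  | mul γ δ hγ hδ =>
    rw [_root_.map_mul, MulAut.mul_apply, hγ, hδ, _root_.map_mul (sphereDiag c p q α β)]
    group

end Cocycle

end FreeGroup

/-! ### The pure mapping class group of the five-punctured sphere -/

namespace FreeGroup

/-- The automorphism of the free group on `c, A, B` through which `p` acts. -/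
def firstPush : MulAut (FreeGroup (Fin 3)) :=
  autOfInverse
    ![(of 2)⁻¹ * of 0 * of 2, of 1 * (of 0)⁻¹ * (of 2)⁻¹ * of 0 * of 2, of 2]
    ![of 2 * of 0 * (of 2)⁻¹, of 1 * (of 0)⁻¹ * of 2 * of 0 * (of 2)⁻¹, of 2]
    (by intro i; fin_cases i <;> simp [mul_assoc]) (by intro i; fin_cases i <;> simp [mul_assoc])

/-- The automorphism of the free group on `c, A, B` through which `q` acts. -/
def secondPush : MulAut (FreeGroup (Fin 3)) :=
  autOfInverse
    ![(of 1)⁻¹ * of 0 * of 1, of 1, (of 1)⁻¹ * of 0 * of 1 * (of 0)⁻¹ * of 2]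
    ![of 1 * of 0 * (of 1)⁻¹, of 1, of 1 * of 0 * (of 1)⁻¹ * (of 0)⁻¹ * of 2]
    (by intro i; fin_cases i <;> simp [mul_assoc]) (by intro i; fin_cases i <;> simp [mul_assoc])

/-- The action of the free group on `p, q` on the free group on `c, A, B` by point pushing. -/
def pushAction : FreeGroup (Fin 2) →* MulAut (FreeGroup (Fin 3)) := lift ![firstPush, secondPush]

/-- The pure mapping class group of the five-punctured sphere, written as the fundamental group of
the space of pairs of distinct points in the plane punctured twice, fibred over the position of the
first point: the base group is free on `p, q` and the fibre group is free on `c, A, B`. -/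
abbrev PureSphere : Type := FreeGroup (Fin 3) ⋊[pushAction] FreeGroup (Fin 2)

namespace PureSphere

open SemidirectProduct

/-- The loop of the second point around the first one, equally a loop of the first point around the
second one. -/
def c : PureSphere := inl (of 0)
/-- The first generator of the base group. -/
def p : PureSphere := inr (of 0)
/-- The second generator of the base group. -/
def q : PureSphere := inr (of 1)
/-- The lift of the first twist: it commutes with `c` and `q`. -/
def α : PureSphere := q * inl (of 1)
/-- The lift of the second twist: it commutes with `c` and `p`. -/
def β : PureSphere := p * inl (of 2)

theorem inr_mul_inl (r : FreeGroup (Fin 2)) (n : FreeGroup (Fin 3)) :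
    (inr r * inl n : PureSphere) = inl (pushAction r n) * inr r := by
  rw [inl_aut]
  simp

theorem p_mul_inl (n : FreeGroup (Fin 3)) : p * inl n = inl (firstPush n) * p := by
  have h : pushAction (of 0) = firstPush := by simp [pushAction]
  rw [p, inr_mul_inl, h]

theorem q_mul_inl (n : FreeGroup (Fin 3)) : q * inl n = inl (secondPush n) * q := by
  have h : pushAction (of 1) = secondPush := by simp [pushAction]
  rw [q, inr_mul_inl, h]

theorem commute_α_c : Commute α c := by
  change q * inl (of 1) * inl (of 0) = inl (of 0) * (q * inl (of 1))
  rw [mul_assoc, ← _root_.map_mul, q_mul_inl, q_mul_inl, ← mul_assoc, ← _root_.map_mul]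
  simp [secondPush, mul_assoc]

theorem commute_α_q : Commute α q := by
  change q * inl (of 1) * q = q * (q * inl (of 1))
  have h : q * inl (of 1) = inl (of 1) * q := by rw [q_mul_inl]; simp [secondPush]
  rw [mul_assoc, ← h]

theorem commute_α_p : Commute ((c * q)⁻¹ * α) p := by
  have h : (c * q)⁻¹ * α = inl (of 1 * (of 0)⁻¹) := by
    rw [inv_mul_eq_iff_eq_mul, α, c, mul_assoc, q_mul_inl, q_mul_inl, ← mul_assoc,
      ← _root_.map_mul]
    simp [secondPush, mul_assoc]
  rw [h]
  change _ = p * _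
  rw [p_mul_inl]
  simp [firstPush, mul_assoc]

theorem commute_β_c : Commute β c := by
  change p * inl (of 2) * inl (of 0) = inl (of 0) * (p * inl (of 2))
  rw [mul_assoc, ← _root_.map_mul, p_mul_inl, p_mul_inl, ← mul_assoc, ← _root_.map_mul]
  simp [firstPush, mul_assoc]

theorem commute_β_p : Commute β p := by
  change p * inl (of 2) * p = p * (p * inl (of 2))
  have h : p * inl (of 2) = inl (of 2) * p := by rw [p_mul_inl]; simp [firstPush]
  rw [mul_assoc, ← h]

theorem commute_β_q : Commute ((p * c)⁻¹ * β) q := by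
  have h : (p * c)⁻¹ * β = inl ((of 0)⁻¹ * of 2) := by
    rw [inv_mul_eq_iff_eq_mul, β, c, mul_assoc, ← _root_.map_mul]
    simp
  rw [h]
  change _ = q * _
  rw [q_mul_inl]
  simp [secondPush, mul_assoc]

end PureSphere

end FreeGroup

/-! ### The congruence subgroup property -/

namespace FreeGroup

/-- The action of the automorphism group on the quotient by a characteristic subgroup. -/
def quotientAut {G : Type*} [Group G] (V : Subgroup G) [V.Characteristic] :
    MulAut G →* MulAut (G ⧸ V) where
  toFun σ := QuotientGroup.congr V V σ (Subgroup.characteristic_iff_map_eq.1 inferInstance σ)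
  map_one' := by
    ext x
    induction x using QuotientGroup.induction_on
    rfl
  map_mul' σ τ := by
    ext x
    induction x using QuotientGroup.induction_on
    rfl

/-- The homomorphism of wreath products induced by a homomorphism of base groups. -/
def wreathMap {D D' Q : Type*} [Group D] [Group D'] [Group Q] (f : D →* D') :
    RegularWreathProduct D Q →* RegularWreathProduct D' Q where
  toFun x := ⟨fun v => f (x.left v), x.right⟩
  map_one' := by ext <;> simp
  map_mul' x y := by ext <;> simp

namespace PureSphere

open SemidirectProduct

/-- The cocycle of the four-punctured sphere, as a fibre of the five-punctured one. -/
def cocycle : FreeGroup (Fin 2) →* RegularWreathProduct PureSphere Klein := sphereCocycle c p q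

/-- The lift of the Sanov action to the pure mapping class group. -/
def twistLift : FreeGroup (Fin 2) →* PureSphere := lift ![α, β]

/-- The retraction of the pure mapping class group onto a quotient `Q` of the group of twists: it
kills `p, q` and `c`, hence the whole group `⟨c, p, q⟩` of the four-punctured sphere. -/
def retraction {Q : Type*} [Group Q] (f : FreeGroup (Fin 2) →* Q) : PureSphere →* Q :=
  SemidirectProduct.lift (FreeGroup.lift ![1, f (of 0), f (of 1)]) 1 (by
    suffices h : ∀ r n, FreeGroup.lift ![1, f (of 0), f (of 1)] (pushAction r n) =
        FreeGroup.lift ![1, f (of 0), f (of 1)] n by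
      intro r
      ext1 n
      simp [h]
    intro r
    induction r using FreeGroup.induction_on with
    | C1 => simp
    | of i =>
      intro n
      induction n using FreeGroup.induction_on with
      | C1 => simp
      | of j => fin_cases i <;> fin_cases j <;> simp [pushAction, firstPush, secondPush]
      | inv_of j h => rw [_root_.map_inv, _root_.map_inv, h, _root_.map_inv]
      | mul x y hx hy => rw [_root_.map_mul, _root_.map_mul, hx, hy, _root_.map_mul]
    | inv_of i h =>
      intro n
      rw [← h, ← MulAut.mul_apply, ← _root_.map_mul]
      simp
    | mul x y hx hy =>
      intro n
      rw [_root_.map_mul, MulAut.mul_apply, hx, hy])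

theorem retraction_inl {Q : Type*} [Group Q] (f : FreeGroup (Fin 2) →* Q) (n : FreeGroup (Fin 3)) :
    retraction f (inl n) = FreeGroup.lift ![1, f (of 0), f (of 1)] n := by
  simp [retraction]

theorem retraction_inr {Q : Type*} [Group Q] (f : FreeGroup (Fin 2) →* Q) (r : FreeGroup (Fin 2)) :
    retraction f (inr r) = 1 := by
  simp [retraction]

theorem retraction_twistLift {Q : Type*} [Group Q] (f : FreeGroup (Fin 2) →* Q)
    (γ : FreeGroup (Fin 2)) : retraction f (twistLift γ) = f γ := by
  have : (retraction f).comp twistLift = f := by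
    ext i
    fin_cases i <;>
      simp [twistLift, α, β, p, q, retraction_inl, retraction_inr]
  exact DFunLike.congr_fun this γ

theorem retraction_cocycle {Q : Type*} [Group Q] (f : FreeGroup (Fin 2) →* Q)
    (x : FreeGroup (Fin 2)) (v : Klein) : retraction f ((cocycle x).left v) = 1 := by
  have hc : retraction f c = 1 := by simp [c, retraction_inl]
  have hp : retraction f p = 1 := retraction_inr f _
  have hq : retraction f q = 1 := retraction_inr f _
  induction x using FreeGroup.induction_on generalizing v with
  | C1 => simp
  | of i =>
    fin_cases i <;> simp only [cocycle, sphereCocycle, lift_apply_of] <;>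
      refine kleinFun_induction (P := fun t => retraction f t = 1) ?_ ?_ ?_ ?_ v <;>
      simp [hc, hp, hq]
  | inv_of i h => simp [h]
  | mul x y hx hy => simp [hx, hy]

end PureSphere

open PureSphere in
/-- The squares of the three loops `c, p, q` are values of the cocycle, at elements of the kernel
of `F₂ → (ℤ/2)²`. -/
theorem cocycle_squares :
    ((cocycle (of 0 * (of 1)⁻¹ * (of 0)⁻¹ * of 1)).right = 1 ∧
      (cocycle (of 0 * (of 1)⁻¹ * (of 0)⁻¹ * of 1)).left 1 = c ^ 2) ∧
    ((cocycle (of 1 * of 0 * (of 1)⁻¹ * (of 0)⁻¹)).right = 1 ∧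
      (cocycle (of 1 * of 0 * (of 1)⁻¹ * (of 0)⁻¹)).left 1 = p ^ 2) ∧
    ((cocycle ((of 1)⁻¹ * (of 0)⁻¹ * of 1 * of 0)).right = 1 ∧
      (cocycle ((of 1)⁻¹ * (of 0)⁻¹ * of 1 * of 0)).left 1 = q ^ 2) := by
  have ha : cocycle (of 0) = ⟨kleinFun c 1 (c * q)⁻¹ q, kleinElt 1 1⟩ := by
    simp [cocycle, sphereCocycle]
  have hb : cocycle (of 1) = ⟨kleinFun p c 1 (p * c)⁻¹, kleinElt 1 0⟩ := by
    simp [cocycle, sphereCocycle]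
  simp only [_root_.map_mul, _root_.map_inv, ha, hb, RegularWreathProduct.mul_left,
    RegularWreathProduct.mul_right, RegularWreathProduct.inv_left, RegularWreathProduct.inv_right,
    Pi.mul_apply, Pi.inv_apply, klein_one, kleinElt_mul, kleinElt_inv, zmod_two_one_add_one,
    add_zero, zero_add, kleinFun_zero_zero, kleinFun_one_zero, kleinFun_zero_one,
    kleinFun_one_one]
  simp [pow_two, mul_assoc]

/-- The commutator `a b⁻¹ a⁻¹ b`, the square of the loop `c` around a puncture. -/
def puncture : FreeGroup (Fin 2) := of 0 * (of 1)⁻¹ * (of 0)⁻¹ * of 1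

theorem sanovAction_puncture (γ : FreeGroup (Fin 2)) : sanovAction γ puncture = puncture := by
  induction γ using FreeGroup.induction_on with
  | C1 => simp
  | of i => fin_cases i <;> simp [puncture, mul_assoc]
  | inv_of i h =>
    nth_rw 1 [← h]
    rw [← MulAut.mul_apply, ← _root_.map_mul]
    simp
  | mul x y hx hy => rw [_root_.map_mul, MulAut.mul_apply, hy, hx]

/-- A finite quotient of `F₂` in which only elements of the kernel of `F₂ → (ℤ/2)²` commute with the
puncture: the wreath product of `ℤ/3` and `(ℤ/2)²`. -/
def punctureDetector : FreeGroup (Fin 2) →* RegularWreathProduct (Multiplicative (ZMod 3)) Klein :=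
  lift ![⟨kleinFun (Multiplicative.ofAdd 1) 1 1 1, kleinElt 1 1⟩, ⟨1, kleinElt 1 0⟩]

theorem punctureDetector_right (x : FreeGroup (Fin 2)) :
    (punctureDetector x).right = (PureSphere.cocycle x).right := by
  have : RegularWreathProduct.rightHom.comp punctureDetector =
      RegularWreathProduct.rightHom.comp PureSphere.cocycle := by
    ext i : 1
    fin_cases i <;> simp [punctureDetector, PureSphere.cocycle, sphereCocycle]
  exact DFunLike.congr_fun this x

theorem right_eq_one_of_commute_puncture {x : FreeGroup (Fin 2)}
    (h : Commute (punctureDetector x) (punctureDetector puncture)) :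
    (PureSphere.cocycle x).right = 1 := by
  have hd : punctureDetector puncture =
      ⟨kleinFun (Multiplicative.ofAdd 1) (Multiplicative.ofAdd (-1)) 1 1, 1⟩ := by
    simp only [puncture, punctureDetector, _root_.map_mul, _root_.map_inv, lift_apply_of]
    refine wreath_ext_klein ?_ ?_ ?_ ?_ ?_
    all_goals decide
  rw [← punctureDetector_right]
  generalize punctureDetector x = e at h ⊢
  have h1 := congrArg (fun z => z.left 1) h.eq
  simp only [hd, RegularWreathProduct.mul_left, Pi.mul_apply, mul_one, inv_one] at h1
  rw [mul_comm] at h1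
  have h2 := mul_right_cancel h1
  revert h2
  generalize e.right = v
  revert v
  decide

theorem commute_inv_mul_of_conj_eq {G : Type*} [Group G] {k x g : G}
    (h : k * x * k⁻¹ = g * x * g⁻¹) : Commute (g⁻¹ * k) x := by
  have h1 : k * x = g * x * g⁻¹ * k := by rw [← h]; group
  rw [Commute, SemiconjBy, mul_assoc, h1]
  group

/-- The congruence subgroup property for the group of twists: every finite quotient `f` of it is
dominated by its outer action on a finite quotient of `F₂`. -/
theorem exists_finite_quotient_sanovAction {Q : Type} [Group Q] [Finite Q]
    (f : FreeGroup (Fin 2) →* Q) :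
    ∃ (E : Type) (_ : Group E) (_ : Finite E) (F : FreeGroup (Fin 2) →* E),
      ∀ γ φ, (∀ x, F (sanovAction γ x) = F (φ * x * φ⁻¹)) → f γ = 1 := by
  -- a finite quotient of the fibre group that controls the centralizer of `c²`
  let f₀ : FreeGroup (Fin 3) →* Q := lift ![1, f (of 0), f (of 1)]
  obtain ⟨E₁, _, _, F₁, h₁⟩ := exists_finite_quotient_commute_sq f₀ 0
  let V : Subgroup (FreeGroup (Fin 3)) := homKernel (FreeGroup (Fin 3)) E₁
  -- the base group acts on it through a finite quotient; the elements that act trivially are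
  -- controlled by the centralizers of `p²` and `q²`
  have : Finite (MulAut (FreeGroup (Fin 3) ⧸ V)) :=
    Finite.of_injective (fun σ : MulAut (FreeGroup (Fin 3) ⧸ V) => (σ : _ → _))
      DFunLike.coe_injective
  let act : FreeGroup (Fin 2) →* MulAut (FreeGroup (Fin 3) ⧸ V) := (quotientAut V).comp pushAction
  obtain ⟨E₂, _, _, F₂, h₂⟩ := exists_finite_quotient_commute_sq_sq act
  let S := (FreeGroup (Fin 3) ⧸ V) ⋊[MonoidHom.id (MulAut (FreeGroup (Fin 3) ⧸ V))]
    MulAut (FreeGroup (Fin 3) ⧸ V)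
  have : Finite S := Finite.of_equiv _ SemidirectProduct.equivProd.symm
  let τ₁ : PureSphere →* S :=
    SemidirectProduct.map (QuotientGroup.mk' V) act fun r => by ext1 n; rfl
  let τ : PureSphere →* S × E₂ := τ₁.prod (F₂.comp SemidirectProduct.rightHom)
  let J := PureSphere.cocycle
  let K := sphereDiag PureSphere.c PureSphere.p PureSphere.q PureSphere.α PureSphere.β
  have hfin : Finite (Multiplicative (ZMod 3)) := inferInstanceAs (Finite (ZMod 3))
  have hfin2 : Finite Klein := inferInstanceAs (Finite (ZMod 2 × ZMod 2))
  refine ⟨RegularWreathProduct (Multiplicative (ZMod 3)) Klein ×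
    RegularWreathProduct (S × E₂) Klein, inferInstance, inferInstance,
    punctureDetector.prod ((wreathMap τ).comp J), fun γ φ h => ?_⟩
  have hφ : (J φ).right = 1 := by
    apply right_eq_one_of_commute_puncture
    have := congrArg Prod.fst (h puncture)
    rw [sanovAction_puncture] at this
    simp only [MonoidHom.prod_apply, _root_.map_mul, _root_.map_inv] at this
    exact (eq_mul_inv_iff_mul_eq.1 this).symm
  have hJ : ∀ x, (J x).right = 1 → Commute (τ (((J φ).left 1)⁻¹ * PureSphere.twistLift γ))
      (τ ((J x).left 1)) := by
    intro x hx
    have h3 : τ ((J (sanovAction γ x)).left 1) = τ ((J (φ * x * φ⁻¹)).left 1) :=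
      congrArg (fun e => e.2.left 1) (h x)
    have h4 : J (sanovAction γ x) = K γ * J x * (K γ)⁻¹ :=
      sphereCocycle_sanovAction PureSphere.commute_α_c PureSphere.commute_α_q
        PureSphere.commute_α_p PureSphere.commute_β_c PureSphere.commute_β_p
        PureSphere.commute_β_q γ x
    have hK1 : (K γ).right = 1 := sphereDiag_right _ _ _ _ _ γ
    have hK2 : (K γ).left 1 = PureSphere.twistLift γ := sphereDiag_left_one _ _ _ _ _ γ
    rw [h4] at h3
    simp only [_root_.map_mul, _root_.map_inv, RegularWreathProduct.mul_left,
      RegularWreathProduct.mul_right, RegularWreathProduct.inv_left, Pi.mul_apply, Pi.inv_apply,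
      hK1, hx, hφ, mul_one, inv_one, hK2] at h3
    rw [_root_.map_mul, _root_.map_inv]
    exact commute_inv_mul_of_conj_eq h3
  set g := ((J φ).left 1)⁻¹ * PureSphere.twistLift γ with hg
  clear_value g
  obtain ⟨⟨rc, ec⟩, ⟨rp, ep⟩, ⟨rq, eq⟩⟩ := cocycle_squares
  have hc := hJ _ rc
  have hp := hJ _ rp
  have hq := hJ _ rq
  rw [ec] at hc
  rw [ep] at hp
  rw [eq] at hq
  have hu : act g.right = 1 := by
    apply h₂
    rw [Commute, SemiconjBy, ← _root_.map_mul, ← _root_.map_mul] at hp hq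
    have hp' : F₂ (g * PureSphere.p ^ 2).right = F₂ (PureSphere.p ^ 2 * g).right :=
      congrArg Prod.snd hp
    have hq' : F₂ (g * PureSphere.q ^ 2).right = F₂ (PureSphere.q ^ 2 * g).right :=
      congrArg Prod.snd hq
    intro i
    fin_cases i
    · simpa [PureSphere.p, pow_two] using hp'
    · simpa [PureSphere.q, pow_two] using hq'
  have hh : f₀ g.left = 1 := by
    rw [Commute, SemiconjBy, ← _root_.map_mul, ← _root_.map_mul] at hc
    have h6 : (((g * PureSphere.c ^ 2).left : FreeGroup (Fin 3)) : FreeGroup (Fin 3) ⧸ V) =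
        ((PureSphere.c ^ 2 * g).left : FreeGroup (Fin 3)) := congrArg (fun e => e.1.left) hc
    have hact : ∀ n : FreeGroup (Fin 3), ((pushAction g.right n : FreeGroup (Fin 3)) :
        FreeGroup (Fin 3) ⧸ V) = n := fun n =>
      congrArg (fun σ : MulAut (FreeGroup (Fin 3) ⧸ V) => σ n) hu
    have h7 : ((g.left * of 0 ^ 2 : FreeGroup (Fin 3)) : FreeGroup (Fin 3) ⧸ V) =
        (of 0 ^ 2 * g.left : FreeGroup (Fin 3)) := by
      rw [PureSphere.c, ← _root_.map_pow, SemidirectProduct.mul_left, SemidirectProduct.mul_left,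
        SemidirectProduct.left_inl, SemidirectProduct.right_inl, _root_.map_one, MulAut.one_apply,
        QuotientGroup.mk_mul, hact, ← QuotientGroup.mk_mul] at h6
      exact h6
    have h8 : F₁ (g.left * of 0 ^ 2) = F₁ (of 0 ^ 2 * g.left) := by
      rw [QuotientGroup.eq] at h7
      have h9 : V ≤ F₁.ker := iInf_le _ F₁
      have := h9 h7
      rw [MonoidHom.mem_ker, _root_.map_mul, _root_.map_inv, inv_mul_eq_one] at this
      exact this
    simp only [_root_.map_mul, _root_.map_pow] at h8
    simpa [f₀] using h₁ _ h8
  have hr : PureSphere.retraction f g = 1 := by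
    rw [← SemidirectProduct.inl_left_mul_inr_right g, _root_.map_mul, PureSphere.retraction_inl,
      PureSphere.retraction_inr, mul_one]
    exact hh
  rw [hg, _root_.map_mul, _root_.map_inv, PureSphere.retraction_cocycle,
    PureSphere.retraction_twistLift, inv_one, one_mul] at hr
  exact hr

/-- The congruence subgroup property: every subgroup of finite index of `Out F₂` contains the
classes of all automorphisms that act as an inner automorphism on a suitable finite quotient
of `F₂`. -/
theorem exists_finite_quotient_out (H : Subgroup (Out (FreeGroup (Fin 2)))) [H.FiniteIndex] :
    ∃ (E : Type) (_ : Group E) (_ : Finite E) (F : FreeGroup (Fin 2) →* E),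
      ∀ (σ : MulAut (FreeGroup (Fin 2))) (φ : FreeGroup (Fin 2)),
        (∀ x, F (σ x) = F (φ * x * φ⁻¹)) → (σ : Out (FreeGroup (Fin 2))) ∈ H := by
  obtain ⟨E, _, _, F, hF⟩ := exists_finite_quotient_sanovAction
    ((QuotientGroup.mk' H.normalCore).comp
      ((QuotientGroup.mk' (Inn (FreeGroup (Fin 2)))).comp sanovAction))
  have hfin : Finite (Multiplicative (ZMod 4)) := inferInstanceAs (Finite (ZMod 4))
  refine ⟨E × (Fin 2 → Multiplicative (ZMod 4)), inferInstance, inferInstance,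
    F.prod (MonoidHom.pi expSum), fun σ φ h => ?_⟩
  obtain ⟨g, γ, rfl⟩ := exists_eq_conj_mul_sanovAction (σ := σ) fun i x => by
    have h1 : expSum i (σ x) = expSum i (φ * x * φ⁻¹) := congrArg (fun e => e.2 i) (h x)
    rw [h1]
    simp
  have hγ : sanovAction γ ∈ (H.normalCore).comap (QuotientGroup.mk' (Inn (FreeGroup (Fin 2)))) := by
    have := hF γ (g⁻¹ * φ) fun x => by
      have h1 : F (g * sanovAction γ x * g⁻¹) = F (φ * x * φ⁻¹) := congrArg Prod.fst (h x)
      have h2 : g⁻¹ * φ * x * (g⁻¹ * φ)⁻¹ = g⁻¹ * (φ * x * φ⁻¹) * g := by group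
      rw [h2, _root_.map_mul, _root_.map_mul, ← h1, ← _root_.map_mul, ← _root_.map_mul]
      congr 1
      group
    exact (QuotientGroup.eq_one_iff (N := H.normalCore)
      (QuotientGroup.mk' (Inn (FreeGroup (Fin 2))) (sanovAction γ))).1 this
  have hg : ((MulAut.conj g : MulAut (FreeGroup (Fin 2))) : Out (FreeGroup (Fin 2))) = 1 :=
    (QuotientGroup.eq_one_iff _).2 ⟨g, rfl⟩
  rw [QuotientGroup.mk_mul, hg, one_mul]
  exact H.normalCore_le hγ

end FreeGroup

/-! ### Automorphisms of a finitely generated profinite completion -/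

theorem MonoidHom.finite_of_fg (G E : Type*) [Group G] [Group.FG G] [Group E] [Finite E] :
    Finite (G →* E) := by
  obtain ⟨S, hS⟩ := (Group.fg_def (G := G)).1 inferInstance
  refine Finite.of_injective (fun (f : G →* E) (s : S) => f s) fun f g hfg => ?_
  exact MonoidHom.eq_of_eqOn_dense hS fun s hs => congrFun hfg ⟨s, hs⟩

namespace ProfCompl

variable {G : Type u} [Group G]

theorem denseRange_eta : DenseRange (eta G) :=
  ProfiniteGrp.ProfiniteCompletion.denseRange (GrpCat.of G)

variable (G) in
/-- An open normal subgroup of the profinite completion that every continuous automorphism maps into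
itself. -/
structure OpenCharSubgroup extends OpenNormalSubgroup (ProfCompl G) where
  map_mem' : ∀ (σ : ProfCompl G ≃ₜ* ProfCompl G), ∀ x ∈ toSubgroup, σ x ∈ toSubgroup

namespace OpenCharSubgroup

variable (V : OpenCharSubgroup G)

theorem isOpen : IsOpen (V.toSubgroup : Set (ProfCompl G)) := V.isOpen'

theorem isClopen : IsClopen (V.toSubgroup : Set (ProfCompl G)) :=
  ⟨Subgroup.isClosed_of_isOpen _ V.isOpen, V.isOpen⟩

instance : V.toSubgroup.Normal := V.isNormal'

theorem map_mem_iff (σ : ProfCompl G ≃ₜ* ProfCompl G) {x : ProfCompl G} :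
    σ x ∈ V.toSubgroup ↔ x ∈ V.toSubgroup := by
  refine ⟨fun h => ?_, V.map_mem' σ x⟩
  simpa using V.map_mem' σ⁻¹ _ h

instance : Finite (ProfCompl G ⧸ V.toSubgroup) := Subgroup.quotient_finite_of_isOpen _ V.isOpen

/-- Finitely generated groups have only finitely many quotients of a given finite order, so that the
intersection of the translates of an open subgroup under automorphisms is open. -/
theorem exists_le_of_mem_nhds [Group.FG G] {U : Set (ProfCompl G)} (hU : U ∈ nhds 1) :
    ∃ V : OpenCharSubgroup G, (V.toSubgroup : Set (ProfCompl G)) ⊆ U := by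
  obtain ⟨O, hOU, hO, h1⟩ := mem_nhds_iff.1 hU
  obtain ⟨N, hN⟩ := ProfiniteGrp.exist_openNormalSubgroup_sub_open_nhds_of_one hO h1
  have hNo : IsOpen (N.toSubgroup : Set (ProfCompl G)) := N.isOpen'
  have hNn : N.toSubgroup.Normal := N.isNormal'
  have : Finite (ProfCompl G ⧸ N.toSubgroup) := Subgroup.quotient_finite_of_isOpen _ hNo
  have hmk : Continuous (QuotientGroup.mk : ProfCompl G → ProfCompl G ⧸ N.toSubgroup) :=
    QuotientGroup.continuous_mk
  have : DiscreteTopology (ProfCompl G ⧸ N.toSubgroup) := QuotientGroup.discreteTopology hNo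
  let T : (ProfCompl G ≃ₜ* ProfCompl G) → Subgroup (ProfCompl G) :=
    fun σ => N.toSubgroup.comap σ.toMulEquiv.toMonoidHom
  let k : (ProfCompl G ≃ₜ* ProfCompl G) → (G →* ProfCompl G ⧸ N.toSubgroup) :=
    fun σ => (QuotientGroup.mk' N.toSubgroup).comp (σ.toMulEquiv.toMonoidHom.comp (eta G))
  have hTk : ∀ σ τ, k σ = k τ → T σ = T τ := by
    intro σ τ h
    have h1 : (fun x => (σ x : ProfCompl G ⧸ N.toSubgroup)) =
        fun x => (τ x : ProfCompl G ⧸ N.toSubgroup) :=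
      denseRange_eta.equalizer (hmk.comp σ.continuous_toFun) (hmk.comp τ.continuous_toFun)
        (funext fun x => DFunLike.congr_fun h x)
    ext x
    have h2 : (σ x : ProfCompl G ⧸ N.toSubgroup) = (τ x : ProfCompl G ⧸ N.toSubgroup) :=
      congrFun h1 x
    change σ x ∈ N.toSubgroup ↔ τ x ∈ N.toSubgroup
    rw [← QuotientGroup.eq_one_iff, ← QuotientGroup.eq_one_iff, h2]
  have hfin : (Set.range T).Finite := by
    have : Finite (G →* ProfCompl G ⧸ N.toSubgroup) := MonoidHom.finite_of_fg _ _
    have h2 : ∀ σ, T σ = T (Function.invFun k (k σ)) := fun σ =>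
      hTk _ _ (Function.invFun_eq ⟨σ, rfl⟩).symm
    refine (Set.finite_range fun f => T (Function.invFun k f)).subset ?_
    rintro _ ⟨σ, rfl⟩
    exact ⟨k σ, (h2 σ).symm⟩
  have hmem : ∀ x, x ∈ sInf (Set.range T) ↔ ∀ σ : ProfCompl G ≃ₜ* ProfCompl G,
      σ x ∈ N.toSubgroup := by
    intro x
    rw [Subgroup.mem_sInf]
    simp only [Set.forall_mem_range]
    rfl
  refine ⟨⟨⟨⟨sInf (Set.range T), ?_⟩, ?_⟩, ?_⟩, ?_⟩
  · change IsOpen ((sInf (Set.range T) : Subgroup (ProfCompl G)) : Set (ProfCompl G))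
    rw [Subgroup.coe_sInf]
    refine hfin.isOpen_biInter ?_
    rintro _ ⟨σ, rfl⟩
    exact hNo.preimage σ.continuous_toFun
  · refine ⟨fun n hn g => ?_⟩
    change g * n * g⁻¹ ∈ sInf (Set.range T)
    rw [hmem]
    intro σ
    rw [map_mul, map_mul, map_inv]
    exact hNn.conj_mem _ ((hmem n).1 hn σ) _
  · intro σ x hx
    change σ x ∈ sInf (Set.range T)
    rw [hmem]
    intro τ
    exact (hmem x).1 hx (τ * σ)
  · exact fun x hx => hOU (hN ((hmem x).1 hx 1))

instance [Group.FG G] : Nonempty (OpenCharSubgroup G) :=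
  ⟨(exists_le_of_mem_nhds (U := Set.univ) Filter.univ_mem).choose⟩

theorem eq_of_forall_mem [Group.FG G] {x y : ProfCompl G}
    (h : ∀ V : OpenCharSubgroup G, x⁻¹ * y ∈ V.toSubgroup) : x = y := by
  by_contra hxy
  have h1 : x⁻¹ * y ≠ 1 := fun h => hxy (inv_mul_eq_one.1 h)
  obtain ⟨V, hV⟩ := exists_le_of_mem_nhds (isOpen_ne.mem_nhds h1.symm)
  exact hV (h V) rfl

/-- Continuity into the profinite completion can be tested modulo open characteristic
subgroups. -/
theorem continuous_of_forall [Group.FG G] {X : Type*} [TopologicalSpace X] {f : X → ProfCompl G}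
    (h : ∀ x₀, ∀ V : OpenCharSubgroup G, {x | (f x₀)⁻¹ * f x ∈ V.toSubgroup} ∈ nhds x₀) :
    Continuous f := by
  rw [continuous_iff_continuousAt]
  intro x₀ U hU
  have h1 : (fun y => f x₀ * y) ⁻¹' U ∈ nhds (1 : ProfCompl G) :=
    (continuous_const_mul (f x₀)).continuousAt (by rwa [mul_one])
  obtain ⟨V, hV⟩ := exists_le_of_mem_nhds h1
  rw [Filter.mem_map]
  filter_upwards [h x₀ V] with x hx
  simpa using hV hx

/-- Congruence of two automorphisms modulo `V` only has to be tested on representatives of the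
cosets of `V`. -/
theorem inv_mul_mem_of_forall_out (σ τ : ProfCompl G ≃ₜ* ProfCompl G)
    (h : ∀ r : ProfCompl G ⧸ V.toSubgroup, (σ r.out)⁻¹ * τ r.out ∈ V.toSubgroup)
    (x : ProfCompl G) : (σ x)⁻¹ * τ x ∈ V.toSubgroup := by
  obtain ⟨v, hv⟩ := QuotientGroup.mk_out_eq_mul V.toSubgroup x
  have h1 := h (x : ProfCompl G ⧸ V.toSubgroup)
  rw [hv, ← QuotientGroup.eq] at h1
  rw [← QuotientGroup.eq]
  rw [map_mul, map_mul, QuotientGroup.mk_mul, QuotientGroup.mk_mul,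
    (QuotientGroup.eq_one_iff (σ v)).2 (V.map_mem' σ _ v.2),
    (QuotientGroup.eq_one_iff (τ v)).2 (V.map_mem' τ _ v.2), mul_one, mul_one] at h1
  exact h1

end OpenCharSubgroup

/-- An automorphism of the profinite completion as a continuous map. -/
noncomputable def toContinuousMap (σ : ProfCompl G ≃ₜ* ProfCompl G) : C(ProfCompl G, ProfCompl G) :=
  ⟨σ, σ.continuous_toFun⟩

theorem isInducing_toContinuousMap : Topology.IsInducing (toContinuousMap (G := G)) := ⟨rfl⟩

theorem continuous_eval (x : ProfCompl G) :
    Continuous fun σ : ProfCompl G ≃ₜ* ProfCompl G => σ x :=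
  (ContinuousEvalConst.continuous_eval_const (F := C(ProfCompl G, ProfCompl G)) x).comp
    isInducing_toContinuousMap.continuous

theorem continuous_eval_uncurry :
    Continuous fun p : (ProfCompl G ≃ₜ* ProfCompl G) × ProfCompl G => p.1 p.2 :=
  (ContinuousEval.continuous_eval (F := C(ProfCompl G, ProfCompl G))).comp
    (isInducing_toContinuousMap.continuous.prodMap continuous_id)

open OpenCharSubgroup

theorem eventually_inv_mul_mem (V : OpenCharSubgroup G) {α : Type*} {l : Filter α}
    {f : α → (ProfCompl G ≃ₜ* ProfCompl G)} {σ : ProfCompl G ≃ₜ* ProfCompl G}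
    (h : ∀ x, Filter.Tendsto (fun a => f a x) l (nhds (σ x))) :
    ∀ᶠ a in l, ∀ x, (σ x)⁻¹ * f a x ∈ V.toSubgroup := by
  have h1 : ∀ r : ProfCompl G ⧸ V.toSubgroup,
      ∀ᶠ a in l, (σ r.out)⁻¹ * f a r.out ∈ V.toSubgroup := by
    intro r
    refine ((h r.out).const_mul (σ r.out)⁻¹).eventually_mem (V.isOpen.mem_nhds ?_)
    simp
  filter_upwards [Filter.eventually_all.2 h1] with a ha
  exact V.inv_mul_mem_of_forall_out σ (f a) ha

section FG

variable [Group.FG G]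

/-- On automorphisms of a finitely generated profinite completion, the topology of uniform
convergence is that of pointwise convergence. -/
theorem tendsto_nhds_iff {α : Type*} {l : Filter α}
    {f : α → (ProfCompl G ≃ₜ* ProfCompl G)} {σ : ProfCompl G ≃ₜ* ProfCompl G} :
    Filter.Tendsto f l (nhds σ) ↔ ∀ x, Filter.Tendsto (fun a => f a x) l (nhds (σ x)) := by
  refine ⟨fun h x => ((continuous_eval x).tendsto σ).comp h, fun h => ?_⟩
  rw [isInducing_toContinuousMap.tendsto_nhds_iff, ContinuousMap.tendsto_nhds_compactOpen]
  intro K hK U hU hKU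
  obtain ⟨N, hN, hNU⟩ := compact_open_separated_mul_right (hK.image σ.continuous_toFun) hU
    (Set.image_subset_iff.2 hKU)
  obtain ⟨V, hV⟩ := exists_le_of_mem_nhds hN
  filter_upwards [eventually_inv_mul_mem V h] with a ha x hx
  have h1 := hNU (Set.mul_mem_mul (Set.mem_image_of_mem _ hx) (hV (ha x)))
  rwa [show σ.toFun x * ((σ x)⁻¹ * f a x) = f a x from mul_inv_cancel_left (σ x) (f a x)] at h1

theorem isInducing_coe : Topology.IsInducing
    fun σ : ProfCompl G ≃ₜ* ProfCompl G => (σ : ProfCompl G → ProfCompl G) := by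
  refine Topology.isInducing_iff_nhds.2 fun σ => le_antisymm ?_ ?_
  · exact ((continuous_pi continuous_eval).tendsto σ).le_comap
  · refine Filter.tendsto_id'.1 (tendsto_nhds_iff.2 fun x => ?_)
    exact ((continuous_apply x).tendsto (σ : ProfCompl G → ProfCompl G)).comp
      Filter.tendsto_comap

theorem continuous_inv : Continuous fun σ : ProfCompl G ≃ₜ* ProfCompl G => σ⁻¹ := by
  refine continuous_iff_continuousAt.2 fun σ => tendsto_nhds_iff.2 fun x => ?_
  have h : Continuous fun σ : ProfCompl G ≃ₜ* ProfCompl G => σ⁻¹ x := by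
    refine continuous_of_forall (G := G) fun τ V => ?_
    have h1 : ∀ᶠ ρ in nhds τ, (ρ (τ⁻¹ x))⁻¹ * x ∈ V.toSubgroup := by
      have h2 : Continuous fun ρ : ProfCompl G ≃ₜ* ProfCompl G => (ρ (τ⁻¹ x))⁻¹ * x :=
        (continuous_eval _).inv.mul continuous_const
      refine h2.continuousAt.eventually_mem (V.isOpen.mem_nhds ?_)
      simp
    filter_upwards [h1] with ρ hρ
    rw [← V.map_mem_iff ρ]
    simpa using hρ
  exact h.tendsto σ

instance : IsTopologicalGroup (ProfCompl G ≃ₜ* ProfCompl G) where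
  continuous_mul := by
    refine continuous_iff_continuousAt.2 fun p => tendsto_nhds_iff.2 fun x => ?_
    have h : Continuous fun q : (ProfCompl G ≃ₜ* ProfCompl G) × (ProfCompl G ≃ₜ* ProfCompl G) =>
        q.1 (q.2 x) :=
      continuous_eval_uncurry.comp
        (continuous_fst.prodMk ((continuous_eval x).comp continuous_snd))
    exact h.tendsto p
  continuous_inv := continuous_inv

/-- The automorphism group is closed in the compact space of pairs of self-maps, an automorphism
being recorded together with its inverse. -/
instance : CompactSpace (ProfCompl G ≃ₜ* ProfCompl G) := by
  let e : (ProfCompl G ≃ₜ* ProfCompl G) →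
      (ProfCompl G → ProfCompl G) × (ProfCompl G → ProfCompl G) := fun σ => (⇑σ, ⇑(σ⁻¹))
  have he : Continuous e :=
    isInducing_coe.continuous.prodMk (isInducing_coe.continuous.comp continuous_inv)
  have hi : Topology.IsInducing e := by
    refine Topology.IsInducing.of_comp he continuous_fst ?_
    exact isInducing_coe
  -- modulo every `V`, the second map inverts the first
  have hr : Set.range e = {p | (∀ x y, p.1 (x * y) = p.1 x * p.1 y) ∧
      ∀ (V : OpenCharSubgroup G) x y,
        y⁻¹ * p.2 x ∈ V.toSubgroup ↔ x⁻¹ * p.1 y ∈ V.toSubgroup} := by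
    refine Set.Subset.antisymm ?_ ?_
    · rintro _ ⟨σ, rfl⟩
      refine ⟨fun x y => map_mul σ x y, fun V x y => ?_⟩
      change y⁻¹ * σ⁻¹ x ∈ V.toSubgroup ↔ x⁻¹ * σ y ∈ V.toSubgroup
      rw [← V.map_mem_iff σ, map_mul, map_inv, ContAut.apply_inv_self, ← inv_mem_iff, mul_inv_rev,
        inv_inv]
    · rintro ⟨f, g⟩ ⟨hf, hfg⟩
      dsimp only at hf hfg
      have h1 : ∀ x, f (g x) = x := fun x =>
        (eq_of_forall_mem fun V => (hfg V x (g x)).1 (by simp)).symm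
      have h2 : ∀ x, g (f x) = x := fun x =>
        (eq_of_forall_mem fun V => (hfg V (f x) x).2 (by simp)).symm
      let F : ProfCompl G ≃* ProfCompl G := ⟨⟨f, g, h2, h1⟩, hf⟩
      have hg1 : g 1 = 1 := map_one F.symm
      have hFV : ∀ (V : OpenCharSubgroup G) y, F y ∈ V.toSubgroup ↔ y ∈ V.toSubgroup := by
        intro V y
        have h3 := hfg V 1 y
        rw [hg1, mul_one, inv_one, one_mul, inv_mem_iff] at h3
        exact h3.symm
      have hcont : ∀ K : ProfCompl G ≃* ProfCompl G,
          (∀ (V : OpenCharSubgroup G) y, K y ∈ V.toSubgroup ↔ y ∈ V.toSubgroup) →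
          Continuous K := by
        intro K hK
        refine continuous_of_forall (G := G) fun x₀ V => ?_
        have h3 : Continuous fun x : ProfCompl G => x₀⁻¹ * x := continuous_const_mul _
        filter_upwards [(V.isOpen.preimage h3).mem_nhds (x := x₀) (by simp)] with x hx
        rw [← map_inv, ← map_mul, hK]
        exact hx
      have hFc : Continuous F := hcont F hFV
      have hGc : Continuous F.symm := hcont F.symm fun V y => by
        rw [← hFV V, MulEquiv.apply_symm_apply]
      exact ⟨⟨F, hFc, hGc⟩, rfl⟩
  have hc : IsClosed (Set.range e) := by
    rw [hr]
    simp only [Set.ofPred_and, Set.ofPred_forall]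
    refine IsClosed.inter ?_ ?_
    · refine isClosed_iInter fun x => isClosed_iInter fun y => isClosed_eq ?_ ?_
      · exact (continuous_apply _).comp continuous_fst
      · exact ((continuous_apply _).comp continuous_fst).mul
          ((continuous_apply _).comp continuous_fst)
    · refine isClosed_iInter fun V => isClosed_iInter fun x => isClosed_iInter fun y => ?_
      have h1 : Continuous fun p : (ProfCompl G → ProfCompl G) × (ProfCompl G → ProfCompl G) =>
          y⁻¹ * p.2 x := continuous_const.mul ((continuous_apply x).comp continuous_snd)
      have h2 : Continuous fun p : (ProfCompl G → ProfCompl G) × (ProfCompl G → ProfCompl G) =>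
          x⁻¹ * p.1 y := continuous_const.mul ((continuous_apply y).comp continuous_fst)
      have h3 := V.isClopen.preimage h1
      have h4 := V.isClopen.preimage h2
      convert (((h3.inter h4).union (h3.compl.inter h4.compl)).isClosed) using 1
      ext p
      simp only [Set.mem_ofPred_eq, Set.mem_union, Set.mem_inter_iff, Set.mem_compl_iff,
        Set.mem_preimage, SetLike.mem_coe]
      tauto
  have hinj : Function.Injective e := fun σ τ h => DFunLike.coe_injective (Prod.ext_iff.1 h).1
  exact Topology.IsClosedEmbedding.compactSpace (f := e) ⟨⟨hi, hinj⟩, hc⟩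

end FG

end ProfCompl

/-! ### The outer automorphism group of a profinite completion is profinite -/

namespace ProfCompl

variable {G : Type u} [Group G]

open OpenCharSubgroup

namespace OpenCharSubgroup

variable (V : OpenCharSubgroup G)

/-- The continuous automorphisms that act on the quotient by `V` as inner automorphisms. -/
def innMod : Subgroup (ProfCompl G ≃ₜ* ProfCompl G) where
  carrier := {σ | ∃ p : ProfCompl G, ∀ y : ProfCompl G,
    (σ y : ProfCompl G ⧸ V.toSubgroup) = (p * y * p⁻¹ : ProfCompl G)}
  one_mem' := ⟨1, fun y => by simp⟩
  mul_mem' := by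
    rintro σ τ ⟨p, hp⟩ ⟨q, hq⟩
    refine ⟨p * q, fun y => ?_⟩
    rw [ContAut.mul_apply, hp, QuotientGroup.mk_mul, QuotientGroup.mk_mul, hq]
    simp only [← QuotientGroup.mk_mul]
    simp only [mul_assoc, mul_inv_rev]
  inv_mem' := by
    rintro σ ⟨p, hp⟩
    refine ⟨p⁻¹, fun z => ?_⟩
    have h := hp (σ⁻¹ z)
    rw [ContAut.apply_inv_self] at h
    rw [QuotientGroup.mk_mul, QuotientGroup.mk_mul, h]
    simp only [← QuotientGroup.mk_mul]
    congr 1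
    group

theorem inn_le_innMod : ContAut.inn (ProfCompl G) ≤ V.innMod := by
  rintro _ ⟨g, rfl⟩
  exact ⟨g, fun y => rfl⟩

/-- The image of `V.innMod` in the outer automorphism group. -/
noncomputable def outMod : Subgroup (ContOut (ProfCompl G)) :=
  V.innMod.map (QuotientGroup.mk' _)

theorem mk_mem_outMod {σ : ProfCompl G ≃ₜ* ProfCompl G} :
    (σ : ContOut (ProfCompl G)) ∈ V.outMod ↔ σ ∈ V.innMod := by
  refine ⟨?_, fun h => ⟨σ, h, rfl⟩⟩
  rintro ⟨τ, hτ, h⟩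
  have h1 := V.inn_le_innMod (QuotientGroup.eq.1 h)
  simpa using mul_mem hτ h1

theorem isOpen_innMod [Group.FG G] : IsOpen (V.innMod : Set (ProfCompl G ≃ₜ* ProfCompl G)) := by
  refine Subgroup.isOpen_of_mem_nhds (g := 1) _ ?_
  filter_upwards [eventually_inv_mul_mem V (f := id) (l := nhds (1 : ProfCompl G ≃ₜ* ProfCompl G))
    (σ := 1) fun x => (continuous_eval x).tendsto 1] with τ hτ
  refine ⟨1, fun y => (QuotientGroup.eq.2 ?_).symm⟩
  simpa using hτ y

end OpenCharSubgroup

variable [Group.FG G]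

theorem mem_inn_of_forall_mem_innMod {σ : ProfCompl G ≃ₜ* ProfCompl G}
    (h : ∀ V : OpenCharSubgroup G, σ ∈ V.innMod) : σ ∈ ContAut.inn (ProfCompl G) := by
  let C : OpenCharSubgroup G → Set (ProfCompl G) := fun V =>
    {p | ∀ y, (σ y)⁻¹ * (p * y * p⁻¹) ∈ V.toSubgroup}
  have hC : ∀ V, IsClosed (C V) := by
    intro V
    simp only [C, Set.ofPred_forall]
    refine isClosed_iInter fun y => V.isClopen.isClosed.preimage ?_
    exact continuous_const.mul ((continuous_id.mul continuous_const).mul continuous_id.inv)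
  have hdir : Directed (fun s t => t ⊆ s) C := by
    intro V W
    have h1 : ((V.toSubgroup ⊓ W.toSubgroup : Subgroup (ProfCompl G)) : Set (ProfCompl G)) ∈
        nhds 1 :=
      Filter.inter_mem (V.isOpen.mem_nhds (one_mem V.toSubgroup))
        (W.isOpen.mem_nhds (one_mem W.toSubgroup))
    obtain ⟨X, hX⟩ := exists_le_of_mem_nhds h1
    exact ⟨X, fun p hp y => (hX (hp y)).1, fun p hp y => (hX (hp y)).2⟩
  obtain ⟨p, hp⟩ := IsCompact.nonempty_iInter_of_directed_nonempty_isCompact_isClosed C hdir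
    (fun V => by
      obtain ⟨p, hp⟩ := h V
      exact ⟨p, fun y => QuotientGroup.eq.1 (hp y)⟩)
    (fun V => (hC V).isCompact) hC
  refine ⟨p, ContinuousMulEquiv.ext fun y => (eq_of_forall_mem (G := G) fun V => ?_).symm⟩
  exact Set.mem_iInter.1 hp V y

theorem OpenCharSubgroup.isOpen_outMod (V : OpenCharSubgroup G) :
    IsOpen (V.outMod : Set (ContOut (ProfCompl G))) :=
  QuotientGroup.isOpenMap_coe _ V.isOpen_innMod

instance : TotallySeparatedSpace (ContOut (ProfCompl G)) := by
  refine totallySeparatedSpace_iff_exists_isClopen.2 fun a b hab => ?_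
  have h1 : ∃ V : OpenCharSubgroup G, a⁻¹ * b ∉ V.outMod := by
    by_contra! h
    refine hab (inv_mul_eq_one.1 ?_)
    obtain ⟨σ, hσ⟩ := QuotientGroup.mk_surjective (a⁻¹ * b)
    rw [← hσ] at h ⊢
    exact (QuotientGroup.eq_one_iff σ).2
      (mem_inn_of_forall_mem_innMod fun V => V.mk_mem_outMod.1 (h V))
  obtain ⟨V, hV⟩ := h1
  have hcl : IsClopen (V.outMod : Set (ContOut (ProfCompl G))) :=
    ⟨Subgroup.isClosed_of_isOpen _ V.isOpen_outMod, V.isOpen_outMod⟩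
  have hc : Continuous fun x : ContOut (ProfCompl G) => a⁻¹ * x := continuous_const_mul _
  refine ⟨_, hcl.preimage hc, ?_, hV⟩
  simp [one_mem]

open CategoryTheory

theorem exists_extendsOutMap :
    ∃ ψ : ProfCompl (Out G) →ₜ* ContOut (ProfCompl G), ExtendsOutMap G ψ := by
  let f : GrpCat.of (Out G) ⟶ GrpCat.of (ProfiniteGrp.of (ContOut (ProfCompl G))) :=
    GrpCat.ofHom (outMap G)
  refine ⟨(ProfiniteGrp.ProfiniteCompletion.lift f).hom, fun a => ?_⟩
  exact ConcreteCategory.congr_hom (ProfiniteGrp.ProfiniteCompletion.lift_eta f) a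

theorem ExtendsOutMap.unique {ψ χ : ProfCompl (Out G) →ₜ* ContOut (ProfCompl G)}
    (hψ : ExtendsOutMap G ψ) (hχ : ExtendsOutMap G χ) : ψ = χ := by
  ext x
  exact congrFun (denseRange_eta.equalizer ψ.continuous_toFun χ.continuous_toFun
    (funext fun a => (hψ a).trans (hχ a).symm)) x

end ProfCompl

/-! ### Injectivity -/

namespace ProfCompl

open CategoryTheory OpenCharSubgroup

/-- A homomorphism to a finite group factors modulo an open characteristic subgroup of the profinite
completion. -/
theorem exists_openCharSubgroup_le_ker {G : Type u} [Group G] [Group.FG G] {E : Type u} [Group E]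
    [Finite E] (F : G →* E) :
    ∃ V : OpenCharSubgroup G, ∀ a b, (eta G a)⁻¹ * eta G b ∈ V.toSubgroup → F a = F b := by
  let _ : TopologicalSpace E := ⊥
  have : DiscreteTopology E := ⟨rfl⟩
  let f : GrpCat.of G ⟶ GrpCat.of (ProfiniteGrp.of E) := GrpCat.ofHom F
  let L : ProfCompl G →ₜ* E := (ProfiniteGrp.ProfiniteCompletion.lift f).hom
  have hL : ∀ a, L (eta G a) = F a := fun a =>
    ConcreteCategory.congr_hom (ProfiniteGrp.ProfiniteCompletion.lift_eta f) a
  have h1 : L ⁻¹' {1} ∈ nhds (1 : ProfCompl G) :=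
    ((isOpen_discrete _).preimage L.continuous_toFun).mem_nhds (map_one L)
  obtain ⟨V, hV⟩ := exists_le_of_mem_nhds h1
  refine ⟨V, fun a b hab => ?_⟩
  have h2 : L ((eta G a)⁻¹ * eta G b) = 1 := hV hab
  rw [map_mul, map_inv, hL, hL] at h2
  exact inv_mul_eq_one.1 h2

/-- If every finite-index subgroup of `Out G` is detected by the outer action on a finite quotient
of `G`, then the extension of `Out G → Out Ĝ` is injective: a nontrivial element is separated from
the identity by an open normal subgroup, whose trace on `Out G` contains that of an open subgroup of
`Out Ĝ`. -/
theorem ExtendsOutMap.injective {G : Type u} [Group G] [Group.FG G]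
    (hG : ∀ (H : Subgroup (Out G)) [H.FiniteIndex],
      ∃ (E : Type u) (_ : Group E) (_ : Finite E) (F : G →* E),
        ∀ (σ : MulAut G) (φ : G), (∀ x, F (σ x) = F (φ * x * φ⁻¹)) → (σ : Out G) ∈ H)
    {ψ : ProfCompl (Out G) →ₜ* ContOut (ProfCompl G)} (hψ : ExtendsOutMap G ψ) :
    Function.Injective ψ := by
  refine (injective_iff_map_eq_one ψ).2 fun ξ hξ => ?_
  by_contra hne
  obtain ⟨U, hU⟩ := ProfiniteGrp.exist_openNormalSubgroup_sub_open_nhds_of_one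
    (isOpen_ne (x := ξ)) (Ne.symm hne)
  have hUo : IsOpen (U.toSubgroup : Set (ProfCompl (Out G))) := U.isOpen'
  have : Finite (ProfCompl (Out G) ⧸ U.toSubgroup) := Subgroup.quotient_finite_of_isOpen _ hUo
  have : U.toSubgroup.FiniteIndex := Subgroup.finiteIndex_of_finite_quotient
  have : (U.toSubgroup.comap (eta (Out G))).FiniteIndex := by
    refine ⟨?_⟩
    rw [Subgroup.index_comap]
    exact Subgroup.FiniteIndex.index_ne_zero (H := U.toSubgroup.subgroupOf _)
  obtain ⟨E, _, _, F, hF⟩ := hG (U.toSubgroup.comap (eta (Out G)))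
  obtain ⟨V, hV⟩ := exists_openCharSubgroup_le_ker F
  -- approximate `ξ` by an outer automorphism of `G` that acts as an inner one modulo `V`
  have h1 : IsOpen {x : ProfCompl (Out G) | ξ⁻¹ * x ∈ U.toSubgroup ∧ ψ x ∈ V.outMod} :=
    (hUo.preimage (continuous_const_mul _)).inter (V.isOpen_outMod.preimage ψ.continuous_toFun)
  obtain ⟨o, ho1, ho2⟩ := denseRange_eta.exists_mem_open h1 ⟨ξ, by simp, by simp [hξ, one_mem]⟩
  obtain ⟨σ, rfl⟩ := QuotientGroup.mk_surjective o
  rw [hψ] at ho2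
  have ho3 : (autMap G σ : ContOut (ProfCompl G)) ∈ V.outMod := ho2
  obtain ⟨p, hp⟩ := V.mk_mem_outMod.1 ho3
  have h2 : Continuous fun q : ProfCompl G => p⁻¹ * q := continuous_const_mul _
  obtain ⟨φ, hφ⟩ := denseRange_eta.exists_mem_open (V.isOpen.preimage h2) ⟨p, by simp⟩
  have h3 : (p : ProfCompl G ⧸ V.toSubgroup) = (eta G φ : ProfCompl G) := QuotientGroup.eq.2 hφ
  have h4 : (σ : Out G) ∈ U.toSubgroup.comap (eta (Out G)) := by
    refine hF σ φ fun x => hV _ _ (QuotientGroup.eq.1 ?_)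
    rw [← autMap_eta, hp]
    simp only [map_mul, map_inv, QuotientGroup.mk_mul, QuotientGroup.mk_inv, h3]
  have h5 := mul_mem (Subgroup.mem_comap.1 h4) (inv_mem ho1)
  rw [mul_inv_rev, inv_inv, mul_inv_cancel_left] at h5
  exact hU h5 rfl

end ProfCompl

theorem mainTheorem1 :
    (∃! ψ : ProfCompl (Out (FreeGroup (Fin 2))) →ₜ* ContOut (ProfCompl (FreeGroup (Fin 2))),
      ProfCompl.ExtendsOutMap (FreeGroup (Fin 2)) ψ) ∧
    ∀ ψ : ProfCompl (Out (FreeGroup (Fin 2))) →ₜ* ContOut (ProfCompl (FreeGroup (Fin 2))),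
      ProfCompl.ExtendsOutMap (FreeGroup (Fin 2)) ψ → Function.Injective ψ := by
  obtain ⟨ψ, hψ⟩ := ProfCompl.exists_extendsOutMap (G := FreeGroup (Fin 2))
  exact ⟨⟨ψ, hψ, fun χ hχ => hχ.unique hψ⟩,
    fun χ hχ => hχ.injective fun H _ => FreeGroup.exists_finite_quotient_out H⟩
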